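/- Write $C_n$ for the cyclic group of order $n$, $D_n$ for the dihedral group of order $2n$, $Q_8$ for the quaternion group of order $8$, and $C_4\circ D_4$ for the central product of order $16$, i.e. the quotient of $C_4\times D_4$ by the subgroup of order $2$ generated by $(z,r^2)$, where $z$ is the element of order $2$ in $C_4$ and $r^2$ is the nontrivial central element of $D_4$. (a) Let $G$ and $K$ be groups. Then $G$ is a nonabelian group of order $16$ that has a subgroup $H\cong K$ of index $2$ such that $G$ is generated by the elements of order $2$ in $G\setminus H$, if and only if $(G,K)$ is, up to isomorphism, one of the four pairs $$(D_8,\,C_8),\qquad (C_2\times D_4,\; C_4\times C_2),\qquad (C_2\times D_4,\; D_4),\qquad (C_4\circ D_4,\; Q_8).$$ These four pairs are pairwise distinct: $D_8$, $C_2\times D_4$ and $C_4\circ D_4$ are pairwise nonisomorphic, and $C_4\times C_2\not\cong D_4$. (b) Let $F$ be a number field with odd class number, let $L/F$ be a normal extension of degree $16$ with nonabelian Galois group $G=\mathrm{Gal}(L/F)$, and let $k$ be a field with $F\subset k\subset L$ and $[k:F]=2$. If every finite prime is unramified in $L/k$, then $G$ is isomorphic to $D_8$, $C_2\times D_4$ or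 $C_4\circ D_4$. If moreover $L/k$ is unramified at the infinite places, then the pair $(G,\mathrm{Gal}(L/k))$ is, up to isomorphism, one of the four pairs in (a). -/

import Mathlib

/-- `G` is generated by the elements of order `2` lying outside the subgroup `H`. -/
def GeneratedByInvolutionsOutside {G : Type*} [Group G] (H : Subgroup G) : Prop :=
  Subgroup.closure {g : G | g ∉ H ∧ orderOf g = 2} = ⊤

/-- The cyclic group `C_n`, written multiplicatively. -/
abbrev Cyc (n : ℕ) : Type := Multiplicative (ZMod n)

/-- The subgroup of `C_4 × D_4` generated by the pair `(z, r²)`, where `z` is the element of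
order `2` of `C_4` and `r²` is the nontrivial central element of the dihedral group `D_4` of
order `8`. -/
abbrev amalgamatedCentre : Subgroup (Cyc 4 × DihedralGroup 4) :=
  Subgroup.zpowers (Multiplicative.ofAdd (2 : ZMod 4), DihedralGroup.r (2 : ZMod 4))

instance amalgamatedCentre_normal : amalgamatedCentre.Normal := by
  have hc : ∀ g : Cyc 4 × DihedralGroup 4,
      g * (Multiplicative.ofAdd (2 : ZMod 4), DihedralGroup.r (2 : ZMod 4)) =
        (Multiplicative.ofAdd (2 : ZMod 4), DihedralGroup.r (2 : ZMod 4)) * g := by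
    rintro ⟨a, b⟩
    have hb : ∀ b : DihedralGroup 4,
        b * DihedralGroup.r (2 : ZMod 4) = DihedralGroup.r (2 : ZMod 4) * b := by decide
    exact Prod.ext (mul_comm _ _) (hb b)
  refine ⟨fun n hn g => ?_⟩
  obtain ⟨k, rfl⟩ := Subgroup.mem_zpowers_iff.mp hn
  have h : Commute g
      ((Multiplicative.ofAdd (2 : ZMod 4), DihedralGroup.r (2 : ZMod 4)) ^ k) :=
    Commute.zpow_right (hc g) k
  rw [h.eq, mul_inv_cancel_right]
  exact hn

/-- The central product `C_4 ∘ D_4` (of order `16`): `C_4 × D_4` with the subgroup of order `2`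
of `C_4` identified with the centre of `D_4`. -/
abbrev C4CentralD4 : Type := (Cyc 4 × DihedralGroup 4) ⧸ amalgamatedCentre

/-- `(G, K)` is, up to isomorphism, one of the pairs `(D_8, C_8)`, `(C_2 × D_4, C_4 × C_2)`,
`(C_2 × D_4, D_4)`, `(C_4 ∘ D_4, Q_8)`. Here `D_n = DihedralGroup n` has order `2n`, and
`QuaternionGroup 2` is the quaternion group `Q_8` of order `8`. -/
def IsTablePair (G K : Type*) [Group G] [Group K] : Prop :=
  (Nonempty (G ≃* DihedralGroup 8) ∧ Nonempty (K ≃* Cyc 8)) ∨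
  (Nonempty (G ≃* (Cyc 2 × DihedralGroup 4)) ∧ Nonempty (K ≃* (Cyc 4 × Cyc 2))) ∨
  (Nonempty (G ≃* (Cyc 2 × DihedralGroup 4)) ∧ Nonempty (K ≃* DihedralGroup 4)) ∨
  (Nonempty (G ≃* C4CentralD4) ∧ Nonempty (K ≃* QuaternionGroup 2))

/-- `G` is, up to isomorphism, one of the groups `D_8`, `C_2 × D_4`, `C_4 ∘ D_4`. -/
def IsTableGroup (G : Type*) [Group G] : Prop :=
  Nonempty (G ≃* DihedralGroup 8) ∨
  Nonempty (G ≃* (Cyc 2 × DihedralGroup 4)) ∨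
  Nonempty (G ≃* C4CentralD4)

/-- The extension of number fields `L/k` is unramified at all finite primes: every nonzero prime
ideal of `𝓞 L` is unramified over `𝓞 k`. -/
def UnramifiedAtFinitePrimes (k L : Type*) [Field k] [Field L] [Algebra k L] : Prop :=
  ∀ (P : Ideal (NumberField.RingOfIntegers L)) [P.IsPrime], P ≠ ⊥ →
    Algebra.IsUnramifiedAt (NumberField.RingOfIntegers k) P

/-!
Let a nonabelian group `G` of order `16` be generated by involutions. Two noncommuting generators
`a`, `b` have a product of order `8`, in which case `G = D_8`, or generate a subgroup `D_4`, which
is normal. In the second case take a further generator `c`. Unless `c * a` has order `8`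
and again `G = D_8`, conjugation by `c` restricts to an inner automorphism of `D_4`, so that
`u = d * c` is central for some `d` in `D_4`, and `u ^ 2 = d ^ 2`. If `d` is a reflection or an
even power of the rotation, then `u ^ 2 = 1` and `G = C_2 × D_4`; otherwise `u ^ 2` is the central
rotation and `G = C_4 ∘ D_4`. When all generators avoid a subgroup `H` of index `2`, then `H`
contains `u` if `d` is a reflection and `a * u` if `d` is a rotation, which determines `H`.

For `G = Gal(L/F)`, the inertia groups and the stabilizers of the infinite places generate `G`:
otherwise they lie in a subgroup of index `2`, whose fixed field is an unramified quadratic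
extension of `F`. As `L/k` is unramified at the finite primes, a nontrivial element of an
inertia group is an involution outside `Gal(L/k)`. A nontrivial element stabilizing an infinite
place is an involution, which lies outside `Gal(L/k)` if `L/k` is unramified at that place.

An unramified quadratic extension `K/F` makes the class number of `F` even. Since the unit rank
more than doubles from `F` to `K`, some unit `ε` of norm `1` is not of the form `τ η / η` with `η`
a unit. By Hilbert's Theorem 90, `ε = τ a / a` for some integer `a`. The ideal `(a)` is
invariant, hence extended from an ideal `J` of `F` because `K/F` is unramified. Then `J ^ 2`, the
norm of `(a)`, is principal, and a generator of `J` would make `ε` trivial.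
-/

section Cardinality

variable {G K : Type*} [Group G] [Group K]

theorem nonempty_mulEquiv_of_injective [Finite G] (f : K →* G) (hf : Function.Injective f)
    (hc : Nat.card G = Nat.card K) : Nonempty (G ≃* K) :=
  ⟨(MulEquiv.ofBijective f (hf.bijective_of_nat_card_le hc.le)).symm⟩

theorem nonempty_mulEquiv_of_surjective [Finite K] (f : K →* G) (hf : Function.Surjective f)
    (hc : Nat.card G = Nat.card K) : Nonempty (G ≃* K) :=
  ⟨(MulEquiv.ofBijective f (hf.bijective_of_nat_card_le hc.ge)).symm⟩

theorem eq_top_of_lt_of_index_eq_two [Finite G] {D R : Subgroup G} (hD : D.index = 2)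
    (hlt : D < R) : R = ⊤ := by
  rw [← Subgroup.index_eq_one]
  have hR : R.index < 2 := hD ▸ Subgroup.index_strictAnti hlt
  have := R.index_ne_zero_of_finite
  omega

end Cardinality

section CyclicLift

variable {G : Type*} [Group G] {n : ℕ} {x : G}

/-- The homomorphism from the cyclic group of order `n` sending the generator `1` to `x`. -/
def cycLift (hx : x ^ n = 1) : Cyc n →* G :=
  AddMonoidHom.toMultiplicativeLeft
    (ZMod.lift n ⟨zmultiplesHom (Additive G) (Additive.ofMul x), by simp [← ofMul_pow, hx]⟩)

theorem cycLift_ofAdd_intCast (hx : x ^ n = 1) (k : ℤ) :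
    cycLift hx (Multiplicative.ofAdd (k : ZMod n)) = x ^ k := by
  change Additive.toMul (ZMod.lift n _ (k : ZMod n)) = x ^ k
  rw [ZMod.lift_coe]
  rfl

theorem cycLift_ofAdd_natCast (hx : x ^ n = 1) (k : ℕ) :
    cycLift hx (Multiplicative.ofAdd (k : ZMod n)) = x ^ k := by
  exact_mod_cast cycLift_ofAdd_intCast hx k

theorem cycLift_ofAdd_one (hx : x ^ n = 1) : cycLift hx (Multiplicative.ofAdd 1) = x := by
  simpa only [Int.cast_one, zpow_one] using cycLift_ofAdd_intCast hx 1

theorem cycLift_ofAdd_sub (hx : x ^ n = 1) (i j : ZMod n) :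
    cycLift hx (Multiplicative.ofAdd (j - i)) =
      (cycLift hx (Multiplicative.ofAdd i))⁻¹ * cycLift hx (Multiplicative.ofAdd j) := by
  rw [sub_eq_neg_add, ofAdd_add, map_mul, ofAdd_neg, map_inv]

theorem range_cycLift (hx : x ^ n = 1) : (cycLift hx).range = Subgroup.zpowers x := by
  ext g
  constructor
  · rintro ⟨i, rfl⟩
    obtain ⟨k, hk⟩ := ZMod.intCast_surjective i.toAdd
    exact ⟨k, by simp only [← cycLift_ofAdd_intCast hx, hk, ofAdd_toAdd]⟩
  · rintro ⟨k, rfl⟩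
    exact ⟨_, cycLift_ofAdd_intCast hx k⟩

theorem cycLift_mem_zpowers (hx : x ^ n = 1) (i : Cyc n) :
    cycLift hx i ∈ Subgroup.zpowers x :=
  range_cycLift hx ▸ ⟨i, rfl⟩

theorem cycLift_injective (hx : x ^ n = 1) (h : orderOf x = n) :
    Function.Injective (cycLift hx) := by
  rw [injective_iff_map_eq_one]
  intro i hi
  obtain ⟨k, hk⟩ := ZMod.intCast_surjective i.toAdd
  rw [← ofAdd_toAdd i, ← hk, cycLift_ofAdd_intCast, ← orderOf_dvd_iff_zpow_eq_one, h,
    ← ZMod.intCast_zmod_eq_zero_iff_dvd _ n, hk] at hi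
  exact toAdd_eq_zero.mp hi

theorem cycLift_mul_of_mul_eq_mul_inv (hx : x ^ n = 1) {t : G} (h : x * t = t * x⁻¹) (i : Cyc n) :
    cycLift hx i * t = t * (cycLift hx i)⁻¹ := by
  obtain ⟨k, hk⟩ := Subgroup.mem_zpowers_iff.mp (cycLift_mem_zpowers hx i)
  have hconj : SemiconjBy t x⁻¹ x := h.symm
  rw [← hk, ← inv_zpow]
  exact (hconj.zpow_right k).eq.symm

theorem card_cyc (n : ℕ) : Nat.card (Cyc n) = n :=
  (Nat.card_congr Multiplicative.toAdd).trans (Nat.card_zmod n)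

theorem notMem_zpowers_of_mul_eq_mul_inv {t : G} (h : x * t = t * x⁻¹) (hx : 2 < orderOf x) :
    t ∉ Subgroup.zpowers x := by
  rintro ⟨k, rfl⟩
  rw [((Commute.refl x).zpow_right k).eq, mul_right_inj, eq_inv_iff_mul_eq_one, ← sq] at h
  exact hx.not_ge (orderOf_le_of_pow_eq_one two_pos h)

theorem nonempty_mulEquiv_cyc_prod_cyc_two [Finite G] {u : G} (hx : orderOf x = n)
    (hu : u ^ 2 = 1) (hxu : Commute x u) (hux : u ∉ Subgroup.zpowers x)
    (hG : Nat.card G = n * 2) : Nonempty (G ≃* (Cyc n × Cyc 2)) := by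
  have hxn : x ^ n = 1 := hx ▸ pow_orderOf_eq_one x
  have hu1 : orderOf u = 2 := orderOf_eq_prime hu fun h => hux (h ▸ one_mem _)
  let f : Cyc n × Cyc 2 →* G := (cycLift hxn).noncommCoprod (cycLift hu) fun i j => by
    obtain ⟨k, hk⟩ := cycLift_mem_zpowers hxn i
    obtain ⟨l, hl⟩ := cycLift_mem_zpowers hu j
    exact hk ▸ hl ▸ hxu.zpow_zpow k l
  refine nonempty_mulEquiv_of_injective f ?_ (by rw [Nat.card_prod, card_cyc, card_cyc, hG])
  refine (MonoidHom.noncommCoprod_injective _ _ _).mpr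
    ⟨cycLift_injective hxn hx, cycLift_injective hu hu1, ?_⟩
  rw [range_cycLift, range_cycLift, Subgroup.disjoint_def]
  rintro _ hk ⟨k, rfl⟩
  obtain ⟨l, rfl | rfl⟩ := Int.even_or_odd' k
  · simp [zpow_mul, hu]
  · simp [zpow_add, zpow_mul, hu, hux] at hk

end CyclicLift

section Dihedral

variable {G : Type*} [Group G] {n : ℕ} {x t : G}

/-- The defining relations of the dihedral group of order `2 * n`, for a rotation `x` and a
reflection `t`. -/
structure DihedralRelations (n : ℕ) (x t : G) : Prop where
  pow_eq_one : x ^ n = 1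
  mul_self : t * t = 1
  mul_eq_mul_inv : x * t = t * x⁻¹

namespace DihedralRelations

theorem of_involutions {a b : G} (ha : a * a = 1) (hb : b * b = 1) (hn : orderOf (a * b) = n) :
    DihedralRelations n (a * b) a where
  pow_eq_one := hn ▸ pow_orderOf_eq_one _
  mul_self := ha
  mul_eq_mul_inv := by
    rw [mul_inv_rev, inv_eq_of_mul_eq_one_left ha, inv_eq_of_mul_eq_one_left hb, mul_assoc]

/-- The homomorphism from the dihedral group sending the standard rotation and reflection to `x`
and `t`. -/
def lift (h : DihedralRelations n x t) : DihedralGroup n →* G :=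
  MonoidHom.mk' (fun d => match d with
    | .r i => cycLift h.pow_eq_one (Multiplicative.ofAdd i)
    | .sr i => t * cycLift h.pow_eq_one (Multiplicative.ofAdd i)) (by
    have hswap := cycLift_mul_of_mul_eq_mul_inv h.pow_eq_one h.mul_eq_mul_inv
    rintro (i | i) (j | j)
    · simp only [DihedralGroup.r_mul_r, ofAdd_add, map_mul]
    · simp only [DihedralGroup.r_mul_sr, cycLift_ofAdd_sub]
      rw [← mul_assoc, ← mul_assoc, hswap]
    · simp only [DihedralGroup.sr_mul_r, ofAdd_add, map_mul, mul_assoc]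
    · simp only [DihedralGroup.sr_mul_sr, cycLift_ofAdd_sub]
      rw [mul_assoc t, ← mul_assoc _ t, hswap, ← mul_assoc, ← mul_assoc, h.mul_self, one_mul])

theorem lift_r (h : DihedralRelations n x t) (i : ZMod n) :
    h.lift (.r i) = cycLift h.pow_eq_one (Multiplicative.ofAdd i) := rfl

theorem lift_sr (h : DihedralRelations n x t) (i : ZMod n) :
    h.lift (.sr i) = t * cycLift h.pow_eq_one (Multiplicative.ofAdd i) := rfl

theorem lift_r_one (h : DihedralRelations n x t) : h.lift (.r 1) = x := by
  rw [lift_r, cycLift_ofAdd_one]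

theorem lift_sr_zero (h : DihedralRelations n x t) : h.lift (.sr 0) = t := by
  rw [lift_sr, ofAdd_zero, map_one, mul_one]

theorem mem_range_lift (h : DihedralRelations n x t) {g : G} :
    g ∈ h.lift.range ↔ ∃ k : ℤ, g = x ^ k ∨ g = t * x ^ k := by
  constructor
  · rintro ⟨(i | i), rfl⟩ <;>
      obtain ⟨k, hk⟩ := cycLift_mem_zpowers h.pow_eq_one (Multiplicative.ofAdd i)
    · exact ⟨k, .inl hk.symm⟩
    · exact ⟨k, .inr (congrArg (t * ·) hk.symm)⟩
  · rintro ⟨k, rfl | rfl⟩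
    · exact ⟨.r k, cycLift_ofAdd_intCast h.pow_eq_one k⟩
    · exact ⟨.sr k, congrArg (t * ·) (cycLift_ofAdd_intCast h.pow_eq_one k)⟩

theorem range_lift (h : DihedralRelations n x t) : h.lift.range = Subgroup.closure {x, t} := by
  have hx : x ∈ Subgroup.closure {x, t} := Subgroup.subset_closure (by simp)
  have ht : t ∈ Subgroup.closure {x, t} := Subgroup.subset_closure (by simp)
  apply le_antisymm
  · intro g hg
    obtain ⟨k, rfl | rfl⟩ := h.mem_range_lift.mp hg
    · exact zpow_mem hx k
    · exact mul_mem ht (zpow_mem hx k)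
  · rw [Subgroup.closure_le]
    rintro g (rfl | rfl)
    · exact ⟨_, h.lift_r_one⟩
    · exact ⟨_, h.lift_sr_zero⟩

theorem lift_injective (h : DihedralRelations n x t) (hx : orderOf x = n)
    (ht : t ∉ Subgroup.zpowers x) : Function.Injective h.lift := by
  rw [injective_iff_map_eq_one]
  rintro (i | i) hi
  · rw [lift_r, map_eq_one_iff _ (cycLift_injective _ hx), ofAdd_eq_one] at hi
    rw [hi, DihedralGroup.r_zero]
  · exact absurd (eq_inv_of_mul_eq_one_left hi ▸ inv_mem (cycLift_mem_zpowers _ _)) ht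

theorem nonempty_mulEquiv [Finite G] (h : DihedralRelations n x t) (hx : orderOf x = n)
    (ht : t ∉ Subgroup.zpowers x) (hG : Nat.card G = 2 * n) :
    Nonempty (G ≃* DihedralGroup n) :=
  nonempty_mulEquiv_of_injective h.lift (h.lift_injective hx ht)
    (hG.trans DihedralGroup.nat_card.symm)

theorem card_closure (h : DihedralRelations n x t) (hx : orderOf x = n)
    (ht : t ∉ Subgroup.zpowers x) : Nat.card (Subgroup.closure {x, t}) = 2 * n := by
  rw [← h.range_lift, ← Nat.card_congr (h.lift.ofInjective (h.lift_injective hx ht)).toEquiv,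
    DihedralGroup.nat_card]

end DihedralRelations

/-- The defining relations of the generalized quaternion group of order `4 * n`. -/
structure QuaternionRelations (n : ℕ) (x t : G) : Prop where
  pow_eq_one : x ^ (2 * n) = 1
  mul_self : t * t = x ^ n
  mul_eq_mul_inv : x * t = t * x⁻¹

namespace QuaternionRelations

/-- The homomorphism from the generalized quaternion group sending the standard generators `a 1`
and `xa 0` to `x` and `t`. -/
def lift (h : QuaternionRelations n x t) : QuaternionGroup n →* G :=
  MonoidHom.mk' (fun d => match d with
    | .a i => cycLift h.pow_eq_one (Multiplicative.ofAdd i)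
    | .xa i => t * cycLift h.pow_eq_one (Multiplicative.ofAdd i)) (by
    have hswap := cycLift_mul_of_mul_eq_mul_inv h.pow_eq_one h.mul_eq_mul_inv
    rintro (i | i) (j | j)
    · simp only [QuaternionGroup.a_mul_a, ofAdd_add, map_mul]
    · simp only [QuaternionGroup.a_mul_xa, cycLift_ofAdd_sub]
      rw [← mul_assoc, ← mul_assoc, hswap]
    · simp only [QuaternionGroup.xa_mul_a, ofAdd_add, map_mul, mul_assoc]
    · simp only [QuaternionGroup.xa_mul_xa, add_sub_assoc, ofAdd_add, map_mul, cycLift_ofAdd_sub,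
        cycLift_ofAdd_natCast]
      rw [mul_assoc t, ← mul_assoc _ t, hswap, ← mul_assoc t, ← mul_assoc t, h.mul_self, mul_assoc])

theorem lift_injective (h : QuaternionRelations n x t) (hx : orderOf x = 2 * n)
    (ht : t ∉ Subgroup.zpowers x) : Function.Injective h.lift := by
  rw [injective_iff_map_eq_one]
  rintro (i | i) hi
  · change cycLift h.pow_eq_one (Multiplicative.ofAdd i) = 1 at hi
    rw [map_eq_one_iff _ (cycLift_injective _ hx), ofAdd_eq_one] at hi
    rw [hi, QuaternionGroup.a_zero]
  · exact absurd (eq_inv_of_mul_eq_one_left hi ▸ inv_mem (cycLift_mem_zpowers _ _)) ht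

theorem nonempty_mulEquiv [Finite G] [NeZero n] (h : QuaternionRelations n x t)
    (hx : orderOf x = 2 * n) (ht : t ∉ Subgroup.zpowers x) (hG : Nat.card G = 4 * n) :
    Nonempty (G ≃* QuaternionGroup n) :=
  nonempty_mulEquiv_of_injective h.lift (h.lift_injective hx ht)
    (by rw [hG, Nat.card_eq_fintype_card, QuaternionGroup.card])

end QuaternionRelations

end Dihedral

section OrderSixteen

variable {G : Type*} [Group G] {x t u c d : G} {H : Subgroup G}

theorem card_eq_eight_of_index_eq_two (hG : Nat.card G = 16) (hH : H.index = 2) :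
    Nat.card H = 8 := by
  have := H.card_mul_index
  rw [hH, hG] at this
  omega

theorem index_eq_two_of_card_eq_eight (hG : Nat.card G = 16) (hH : Nat.card H = 8) :
    H.index = 2 := by
  have := H.card_mul_index
  rw [hH, hG] at this
  omega

/-- Generators of a group of order `16` in normal form: `x` and `t` generate a dihedral group of
order `8`, which together with the central element `u` generates the whole group. -/
structure DihedralCentralTriple (x t u : G) : Prop extends DihedralRelations 4 x t where
  orderOf_eq : orderOf x = 4
  commute_left : Commute u x
  commute_right : Commute u t
  notMem_closure : u ∉ Subgroup.closure {x, t}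

namespace DihedralCentralTriple

theorem notMem_zpowers (T : DihedralCentralTriple x t u) : t ∉ Subgroup.zpowers x :=
  notMem_zpowers_of_mul_eq_mul_inv T.mul_eq_mul_inv (by rw [T.orderOf_eq]; norm_num)

theorem commute_of_mem_closure (T : DihedralCentralTriple x t u)
    (hd : d ∈ Subgroup.closure {x, t}) : Commute u d := by
  have hle : Subgroup.closure {x, t} ≤ Subgroup.centralizer {u} := by
    rw [Subgroup.closure_le]
    rintro g (rfl | rfl)
    · exact Subgroup.mem_centralizer_singleton_iff.mpr T.commute_left.symm.eq
    · exact Subgroup.mem_centralizer_singleton_iff.mpr T.commute_right.symm.eq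
  exact (Subgroup.mem_centralizer_singleton_iff.mp (hle hd)).symm

/-- The homomorphism from `C_n × D_4` given by the central element `u` and the dihedral group
generated by `x` and `t`. -/
def prodLift (T : DihedralCentralTriple x t u) {n : ℕ} (hu : u ^ n = 1) :
    Cyc n × DihedralGroup 4 →* G :=
  (cycLift hu).noncommCoprod T.lift fun i d => by
    obtain ⟨k, hk⟩ := Subgroup.mem_zpowers_iff.mp (cycLift_mem_zpowers hu i)
    rw [← hk]
    exact (T.commute_of_mem_closure (T.range_lift ▸ ⟨d, rfl⟩)).zpow_left k

theorem prodLift_apply (T : DihedralCentralTriple x t u) {n : ℕ} (hu : u ^ n = 1)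
    (p : Cyc n × DihedralGroup 4) : T.prodLift hu p = cycLift hu p.1 * T.lift p.2 := rfl

theorem prodLift_surjective (T : DihedralCentralTriple x t u) (hG : Nat.card G = 16) {n : ℕ}
    (hu : u ^ n = 1) : Function.Surjective (T.prodLift hu) := by
  have : Finite G := Nat.finite_of_card_ne_zero (by omega)
  rw [← MonoidHom.range_eq_top]
  refine eq_top_of_lt_of_index_eq_two
    (index_eq_two_of_card_eq_eight hG (T.card_closure T.orderOf_eq T.notMem_zpowers))
    (SetLike.lt_iff_le_and_exists.mpr ⟨?_, u,
      MonoidHom.mem_range.mpr ⟨(Multiplicative.ofAdd 1, 1), ?_⟩, T.notMem_closure⟩)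
  · rw [← T.range_lift]
    rintro _ ⟨d, rfl⟩
    exact ⟨(1, d), by rw [prodLift_apply, map_one, one_mul]⟩
  · rw [prodLift_apply, cycLift_ofAdd_one, map_one, mul_one]

theorem nonempty_mulEquiv_cyc_two_prod (T : DihedralCentralTriple x t u) (hG : Nat.card G = 16)
    (hu : u ^ 2 = 1) : Nonempty (G ≃* (Cyc 2 × DihedralGroup 4)) :=
  nonempty_mulEquiv_of_surjective _ (T.prodLift_surjective hG hu)
    (by rw [Nat.card_prod, card_cyc, DihedralGroup.nat_card, hG])

end DihedralCentralTriple

theorem card_c4CentralD4 : Nat.card C4CentralD4 = 16 := by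
  have hZ : Nat.card amalgamatedCentre = 2 := by
    rw [Nat.card_zpowers]
    exact orderOf_eq_prime (by decide) (by decide)
  have h := amalgamatedCentre.card_eq_card_quotient_mul_card_subgroup
  rw [hZ, Nat.card_prod, card_cyc, DihedralGroup.nat_card] at h
  exact Nat.eq_of_mul_eq_mul_right two_pos h.symm

namespace DihedralCentralTriple

theorem nonempty_mulEquiv_c4CentralD4 (T : DihedralCentralTriple x t u) (hG : Nat.card G = 16)
    (hu : u ^ 2 = x ^ 2) : Nonempty (G ≃* C4CentralD4) := by
  have hu4 : u ^ 4 = 1 := by rw [pow_mul u 2 2, hu, ← pow_mul, T.pow_eq_one]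
  have hle : amalgamatedCentre ≤ (T.prodLift hu4).ker := by
    rw [Subgroup.zpowers_le, MonoidHom.mem_ker, T.prodLift_apply, T.lift_r]
    have hu' := cycLift_ofAdd_natCast hu4 2
    have hx' := cycLift_ofAdd_natCast T.pow_eq_one 2
    rw [Nat.cast_ofNat] at hu' hx'
    rw [hu', hx', hu, ← pow_add, T.pow_eq_one]
  exact nonempty_mulEquiv_of_surjective (QuotientGroup.lift _ _ hle)
    (QuotientGroup.lift_surjective_of_surjective _ _ (T.prodLift_surjective hG hu4) hle)
    (by rw [hG, card_c4CentralD4])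

theorem nonempty_subgroup_mulEquiv_cyc_four_prod (T : DihedralCentralTriple x t u)
    (hH : Nat.card H = 8) (hu : u ^ 2 = 1) (hxH : x ∈ H) (huH : u ∈ H) :
    Nonempty (H ≃* (Cyc 4 × Cyc 2)) := by
  have : Finite H := Nat.finite_of_card_ne_zero (by omega)
  have hux : u ∉ Subgroup.zpowers x := fun h =>
    T.notMem_closure (Subgroup.zpowers_le.mpr (Subgroup.subset_closure (by simp)) h)
  refine nonempty_mulEquiv_cyc_prod_cyc_two (x := ⟨x, hxH⟩) (u := ⟨u, huH⟩)
    ((Subgroup.orderOf_mk x hxH).trans T.orderOf_eq) (Subtype.ext hu)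
    (Subtype.ext T.commute_left.symm.eq) ?_ hH
  rintro ⟨k, hk⟩
  exact hux ⟨k, congrArg Subtype.val hk⟩

theorem mul_mul_self (T : DihedralCentralTriple x t u) : t * u * (t * u) = u ^ 2 := by
  rw [T.commute_right.mul_mul_mul_comm, T.mul_self, one_mul, sq]

theorem mul_mul_eq_mul_mul_inv (T : DihedralCentralTriple x t u) : x * (t * u) = t * u * x⁻¹ := by
  rw [← mul_assoc, T.mul_eq_mul_inv, mul_assoc, mul_assoc, T.commute_left.inv_right.eq]

theorem notMem_zpowers_subgroup (T : DihedralCentralTriple x t u) (hxH : x ∈ H)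
    (htuH : t * u ∈ H) : (⟨t * u, htuH⟩ : H) ∉ Subgroup.zpowers ⟨x, hxH⟩ :=
  notMem_zpowers_of_mul_eq_mul_inv (Subtype.ext T.mul_mul_eq_mul_mul_inv)
    (by rw [Subgroup.orderOf_mk, T.orderOf_eq]; norm_num)

theorem nonempty_subgroup_mulEquiv_dihedralGroup (T : DihedralCentralTriple x t u)
    (hH : Nat.card H = 8) (hu : u ^ 2 = 1) (hxH : x ∈ H) (htuH : t * u ∈ H) :
    Nonempty (H ≃* DihedralGroup 4) := by
  have : Finite H := Nat.finite_of_card_ne_zero (by omega)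
  have h : DihedralRelations 4 (⟨x, hxH⟩ : H) ⟨t * u, htuH⟩ :=
    ⟨Subtype.ext T.pow_eq_one, Subtype.ext (T.mul_mul_self.trans hu),
      Subtype.ext T.mul_mul_eq_mul_mul_inv⟩
  exact h.nonempty_mulEquiv ((Subgroup.orderOf_mk x hxH).trans T.orderOf_eq)
    (T.notMem_zpowers_subgroup hxH htuH) hH

theorem nonempty_subgroup_mulEquiv_quaternionGroup (T : DihedralCentralTriple x t u)
    (hH : Nat.card H = 8) (hu : u ^ 2 = x ^ 2) (hxH : x ∈ H) (htuH : t * u ∈ H) :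
    Nonempty (H ≃* QuaternionGroup 2) := by
  have : Finite H := Nat.finite_of_card_ne_zero (by omega)
  have h : QuaternionRelations 2 (⟨x, hxH⟩ : H) ⟨t * u, htuH⟩ :=
    ⟨Subtype.ext T.pow_eq_one, Subtype.ext (T.mul_mul_self.trans hu),
      Subtype.ext T.mul_mul_eq_mul_mul_inv⟩
  exact h.nonempty_mulEquiv ((Subgroup.orderOf_mk x hxH).trans T.orderOf_eq)
    (T.notMem_zpowers_subgroup hxH htuH) hH

theorem sq_eq_sq_of_mul_self_eq_one (T : DihedralCentralTriple x t (d * c))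
    (hd : d ∈ Subgroup.closure {x, t}) (hc : c * c = 1) : (d * c) ^ 2 = d ^ 2 := by
  have hdc : Commute c d := by
    have := T.commute_of_mem_closure hd
    rwa [Commute, SemiconjBy, mul_assoc, mul_right_inj] at this
  rw [hdc.symm.mul_pow, sq c, hc, mul_one]

theorem sq_eq_one_or_exists_zpow (T : DihedralCentralTriple x t (d * c))
    (hd : d ∈ Subgroup.closure {x, t}) (hc : c * c = 1) :
    ((∃ k : ℤ, d = t * x ^ k) ∧ (d * c) ^ 2 = 1) ∨
      ((∃ k : ℤ, d = x ^ k) ∧ ((d * c) ^ 2 = 1 ∨ (d * c) ^ 2 = x ^ 2)) := by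
  rw [T.sq_eq_sq_of_mul_self_eq_one hd hc]
  rw [← T.range_lift, T.mem_range_lift] at hd
  have hx4 : (x ^ 2) ^ 2 = 1 := by rw [← pow_mul, T.pow_eq_one]
  obtain ⟨k, rfl | rfl⟩ := hd
  · have hcomm : (x ^ k) ^ 2 = (x ^ 2) ^ k := by rw [← zpow_natCast, zpow_comm, zpow_natCast]
    refine .inr ⟨⟨k, rfl⟩, ?_⟩
    rw [hcomm]
    obtain ⟨j, rfl | rfl⟩ := Int.even_or_odd' k
    · exact .inl (by rw [zpow_mul, zpow_ofNat, hx4, one_zpow])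
    · exact .inr (by rw [zpow_add_one, zpow_mul, zpow_ofNat, hx4, one_zpow, one_mul])
  · refine .inl ⟨⟨k, rfl⟩, ?_⟩
    have hswap : SemiconjBy t (x⁻¹ ^ k) (x ^ k) :=
      SemiconjBy.zpow_right (T.mul_eq_mul_inv.symm : SemiconjBy t x⁻¹ x) k
    rw [sq, mul_assoc, ← mul_assoc _ t, ← hswap.eq, inv_zpow, inv_mul_cancel_right, T.mul_self]

theorem isTableGroup (T : DihedralCentralTriple x t (d * c)) (hG : Nat.card G = 16)
    (hd : d ∈ Subgroup.closure {x, t}) (hc : c * c = 1) : IsTableGroup G := by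
  obtain ⟨-, hu⟩ | ⟨-, hu | hu⟩ := T.sq_eq_one_or_exists_zpow hd hc
  · exact .inr (.inl (T.nonempty_mulEquiv_cyc_two_prod hG hu))
  · exact .inr (.inl (T.nonempty_mulEquiv_cyc_two_prod hG hu))
  · exact .inr (.inr (T.nonempty_mulEquiv_c4CentralD4 hG hu))

theorem isTablePair (T : DihedralCentralTriple x t (d * c)) (hG : Nat.card G = 16)
    (hd : d ∈ Subgroup.closure {x, t}) (hc : c * c = 1) (hH : H.index = 2) (htH : t ∉ H)
    (htxH : t * x ∉ H) (hcH : c ∉ H) : IsTablePair G H := by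
  have hH8 := card_eq_eight_of_index_eq_two hG hH
  have hmul {a b : G} : a * b ∈ H ↔ (a ∈ H ↔ b ∈ H) := Subgroup.mul_mem_iff_of_index_two hH
  have hxH : x ∈ H := by rw [hmul] at htxH; tauto
  obtain ⟨⟨k, rfl⟩, hu⟩ | ⟨⟨k, rfl⟩, hu⟩ := T.sq_eq_one_or_exists_zpow hd hc <;>
    have hk := zpow_mem hxH k
  · have huH : t * x ^ k * c ∈ H := by rw [hmul, hmul]; tauto
    exact .inr (.inl ⟨T.nonempty_mulEquiv_cyc_two_prod hG hu,
      T.nonempty_subgroup_mulEquiv_cyc_four_prod hH8 hu hxH huH⟩)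
  · have htuH : t * (x ^ k * c) ∈ H := by rw [hmul, hmul]; tauto
    obtain hu | hu := hu
    · exact .inr (.inr (.inl ⟨T.nonempty_mulEquiv_cyc_two_prod hG hu,
        T.nonempty_subgroup_mulEquiv_dihedralGroup hH8 hu hxH htuH⟩))
    · exact .inr (.inr (.inr ⟨T.nonempty_mulEquiv_c4CentralD4 hG hu,
        T.nonempty_subgroup_mulEquiv_quaternionGroup hH8 hu hxH htuH⟩))

end DihedralCentralTriple

end OrderSixteen

section Classification

variable {G : Type*} [Group G] {x t c : G}

theorem exists_mulAut_map_eq_conj {K : Type*} [Group K] (f : K →* G) (hf : Function.Injective f)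
    (hn : f.range.Normal) (c : G) : ∃ φ : MulAut K, ∀ k, f (φ k) = c * f k * c⁻¹ := by
  let e := f.ofInjective hf
  refine ⟨(e.trans (MulAut.conjNormal c)).trans e.symm, fun k => ?_⟩
  rw [← f.ofInjective_apply hf, MulEquiv.trans_apply, MulEquiv.apply_symm_apply]
  exact MulAut.conjNormal_apply c (e k)

/-- The outer automorphisms of `D_4` are those moving a reflection to the other class of
reflections. -/
theorem exists_conj_mulAut_dihedralGroup_four_eq (φ : MulAut (DihedralGroup 4))
    (hφ : (φ (.sr 0) * .sr 0) ^ 2 = 1) :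
    ∃ d, d * φ (.r 1) * d⁻¹ = .r 1 ∧ d * φ (.sr 0) * d⁻¹ = .sr 0 := by
  have hr : φ (.r 1) * φ (.r 1) ≠ 1 := by
    rw [← map_mul, ne_eq, EmbeddingLike.map_eq_one_iff]
    decide
  have hrs : φ (.r 1) * φ (.sr 0) ≠ φ (.sr 0) * φ (.r 1) := by
    rw [← map_mul, ← map_mul, ne_eq, EmbeddingLike.apply_eq_iff_eq]
    decide
  have hconj : ∀ a b : DihedralGroup 4, (b * .sr 0) ^ 2 = 1 → a * a ≠ 1 → a * b ≠ b * a →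
      ∃ d : DihedralGroup 4, d * a * d⁻¹ = .r 1 ∧ d * b * d⁻¹ = .sr 0 := by decide
  exact hconj _ _ hφ hr hrs

theorem exists_mem_closure_commute (h : DihedralRelations 4 x t) (hx : orderOf x = 4)
    (hn : (Subgroup.closure {x, t}).Normal) (hc : c * c = 1) (hct : orderOf (c * t) ≠ 8) :
    ∃ d ∈ Subgroup.closure {x, t}, Commute (d * c) x ∧ Commute (d * c) t := by
  have hinj : Function.Injective h.lift := h.lift_injective hx
    (notMem_zpowers_of_mul_eq_mul_inv h.mul_eq_mul_inv (by rw [hx]; norm_num))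
  rw [← h.range_lift] at hn ⊢
  obtain ⟨φ, hφ⟩ := exists_mulAut_map_eq_conj h.lift hinj hn c
  have hsq : h.lift (φ (.sr 0) * .sr 0) = (c * t) ^ 2 := by
    rw [map_mul, hφ, h.lift_sr_zero, inv_eq_of_mul_eq_one_left hc, sq, mul_assoc (c * t)]
  have hinner : (φ (.sr 0) * .sr 0) ^ 2 = 1 := by
    by_contra hne
    refine hct (orderOf_eq_prime_pow (p := 2) (n := 2) ?_ ?_)
    · rwa [pow_succ, pow_one, pow_mul, ← hsq, ← map_pow, map_eq_one_iff _ hinj]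
    · have h4 : ∀ d : DihedralGroup 4, d ^ 4 = 1 := by decide
      rw [show 2 ^ (2 + 1) = 2 * 4 from rfl, pow_mul, ← hsq, ← map_pow, h4, map_one]
  obtain ⟨d, hdr, hds⟩ := exists_conj_mulAut_dihedralGroup_four_eq φ hinner
  have hcomm {e : DihedralGroup 4} (he : d * φ e * d⁻¹ = e) :
      Commute (h.lift d * c) (h.lift e) := by
    rw [Commute, SemiconjBy, ← mul_inv_eq_iff_eq_mul, mul_inv_rev]
    conv_rhs => rw [← he, map_mul, map_mul, hφ, map_inv]
    simp only [mul_assoc]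
  refine ⟨h.lift d, ⟨d, rfl⟩, ?_, ?_⟩
  · simpa only [h.lift_r_one] using hcomm hdr
  · simpa only [h.lift_sr_zero] using hcomm hds

theorem orderOf_mul_eq_four_or_eight {a b : G} (hG : Nat.card G = 16)
    (ha : a * a = 1) (hb : b * b = 1) (hab : a * b ≠ b * a) :
    orderOf (a * b) = 4 ∨ orderOf (a * b) = 8 := by
  have : Finite G := Nat.finite_of_card_ne_zero (by omega)
  have hsq : (a * b) ^ 2 ≠ 1 := fun h => hab <| by
    rwa [sq, mul_eq_one_iff_eq_inv, mul_inv_rev, inv_eq_of_mul_eq_one_left ha,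
      inv_eq_of_mul_eq_one_left hb] at h
  have hne : orderOf (a * b) ≠ 16 := fun h => hab <| by
    have := (isCyclic_of_orderOf_eq_card (a * b) (h.trans hG.symm)).isMulCommutative
    exact mul_comm' a b
  have hdvd : orderOf (a * b) ∣ 2 ^ 4 := by simpa [hG] using orderOf_dvd_natCard (a * b)
  obtain ⟨m, hm, hm'⟩ := (Nat.dvd_prime_pow Nat.prime_two).mp hdvd
  have hm2 : ¬ m ≤ 1 := fun h =>
    hsq (orderOf_dvd_iff_pow_eq_one.mp (hm' ▸ pow_dvd_pow 2 h))
  interval_cases m <;> simp_all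

theorem exists_not_commute_of_closure_eq_top {S : Set G} (hgen : Subgroup.closure S = ⊤)
    (hG : ¬ ∀ a b : G, a * b = b * a) : ∃ a ∈ S, ∃ b ∈ S, a * b ≠ b * a := by
  by_contra! hcomm
  have := Subgroup.isMulCommutative_closure hcomm
  refine hG fun a b => ?_
  have h := mul_comm' (⟨a, hgen ▸ Subgroup.mem_top a⟩ : Subgroup.closure S)
    ⟨b, hgen ▸ Subgroup.mem_top b⟩
  exact congrArg Subtype.val h

theorem exists_orderOf_eq_eight_or_dihedralCentralTriple (hG : Nat.card G = 16)
    (hna : ¬ ∀ a b : G, a * b = b * a) {S : Set G} (hS : ∀ s ∈ S, s * s = 1)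
    (hgen : Subgroup.closure S = ⊤) :
    (∃ a ∈ S, ∃ b ∈ S, orderOf (a * b) = 8) ∨
      ∃ a ∈ S, ∃ b ∈ S, ∃ c ∈ S, ∃ d ∈ Subgroup.closure {a * b, a},
        DihedralCentralTriple (a * b) a (d * c) := by
  rw [or_iff_not_imp_left]
  intro h8
  push Not at h8
  obtain ⟨a, ha, b, hb, hab⟩ := exists_not_commute_of_closure_eq_top hgen hna
  have hx : orderOf (a * b) = 4 :=
    (orderOf_mul_eq_four_or_eight hG (hS a ha) (hS b hb) hab).resolve_right (h8 a ha b hb)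
  have h := DihedralRelations.of_involutions (hS a ha) (hS b hb) hx
  have hD : (Subgroup.closure {a * b, a}).index = 2 := index_eq_two_of_card_eq_eight hG
    (h.card_closure hx (notMem_zpowers_of_mul_eq_mul_inv h.mul_eq_mul_inv (by rw [hx]; norm_num)))
  obtain ⟨c, hc, hcD⟩ : ∃ c ∈ S, c ∉ Subgroup.closure {a * b, a} := by
    by_contra! hle
    rw [top_le_iff.mp (hgen.ge.trans ((Subgroup.closure_le _).mpr hle)), Subgroup.index_top] at hD
    omega
  obtain ⟨d, hd, hdx, hdt⟩ := exists_mem_closure_commute h hx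
    (Subgroup.normal_of_index_eq_two hD) (hS c hc) (h8 c hc a ha)
  exact ⟨a, ha, b, hb, c, hc, d, hd, h, hx, hdx, hdt,
    fun hdc => hcD ((Subgroup.mul_mem_cancel_left _ hd).mp hdc)⟩

section OrderEight

variable {a b : G} (hG : Nat.card G = 16) (ha : a * a = 1) (hb : b * b = 1)
  (h8 : orderOf (a * b) = 8)
include hG ha hb h8

theorem nonempty_mulEquiv_dihedralGroup_eight : Nonempty (G ≃* DihedralGroup 8) := by
  have : Finite G := Nat.finite_of_card_ne_zero (by omega)
  have h := DihedralRelations.of_involutions ha hb h8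
  exact h.nonempty_mulEquiv h8
    (notMem_zpowers_of_mul_eq_mul_inv h.mul_eq_mul_inv (by rw [h8]; norm_num)) hG

theorem isTablePair_of_orderOf_mul_eq_eight {H : Subgroup G} (hH : H.index = 2) (haH : a ∉ H)
    (hbH : b ∉ H) : IsTablePair G H := by
  have hxH : a * b ∈ H := (Subgroup.mul_mem_iff_of_index_two hH).mpr (by tauto)
  have hH8 := card_eq_eight_of_index_eq_two hG hH
  have : Finite H := Nat.finite_of_card_ne_zero (by omega)
  have := isCyclic_of_orderOf_eq_card (⟨a * b, hxH⟩ : H)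
    ((Subgroup.orderOf_mk _ _).trans (h8.trans hH8.symm))
  exact .inl ⟨nonempty_mulEquiv_dihedralGroup_eight hG ha hb h8,
    ⟨mulEquivOfCyclicCardEq (hH8.trans (card_cyc 8).symm)⟩⟩

end OrderEight

theorem isTableGroup_of_closure_involutions (hG : Nat.card G = 16)
    (hna : ¬ ∀ a b : G, a * b = b * a) {S : Set G} (hS : ∀ s ∈ S, s * s = 1)
    (hgen : Subgroup.closure S = ⊤) : IsTableGroup G := by
  obtain ⟨a, ha, b, hb, h8⟩ | ⟨a, -, b, -, c, hc, d, hd, T⟩ :=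
    exists_orderOf_eq_eight_or_dihedralCentralTriple hG hna hS hgen
  · exact .inl (nonempty_mulEquiv_dihedralGroup_eight hG (hS a ha) (hS b hb) h8)
  · exact T.isTableGroup hG hd (hS c hc)

theorem isTablePair_of_closure_involutions (hG : Nat.card G = 16)
    (hna : ¬ ∀ a b : G, a * b = b * a) {S : Set G} (hS : ∀ s ∈ S, s * s = 1)
    (hgen : Subgroup.closure S = ⊤) {H : Subgroup G} (hH : H.index = 2) (hSH : ∀ s ∈ S, s ∉ H) :
    IsTablePair G H := by
  obtain ⟨a, ha, b, hb, h8⟩ | ⟨a, ha, b, hb, c, hc, d, hd, T⟩ :=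
    exists_orderOf_eq_eight_or_dihedralCentralTriple hG hna hS hgen
  · exact isTablePair_of_orderOf_mul_eq_eight hG (hS a ha) (hS b hb) h8 hH (hSH a ha) (hSH b hb)
  · refine T.isTablePair hG hd (hS c hc) hH (hSH a ha) ?_ (hSH c hc)
    rw [← mul_assoc, hS a ha, one_mul]
    exact hSH b hb

theorem isTablePair_of_generatedByInvolutionsOutside (hG : Nat.card G = 16)
    (hna : ¬ ∀ a b : G, a * b = b * a) {H : Subgroup G} (hH : H.index = 2)
    (hgen : GeneratedByInvolutionsOutside H) : IsTablePair G H :=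
  isTablePair_of_closure_involutions hG hna
    (fun s hs => by rw [← sq, ← hs.2, pow_orderOf_eq_one]) hgen hH fun _ hs => hs.1

theorem IsTablePair.of_mulEquiv {G K G' K' : Type*} [Group G] [Group K] [Group G'] [Group K']
    (h : IsTablePair G' K') (e : G ≃* G') (f : K ≃* K') : IsTablePair G K := by
  rcases h with ⟨⟨a⟩, ⟨b⟩⟩ | ⟨⟨a⟩, ⟨b⟩⟩ | ⟨⟨a⟩, ⟨b⟩⟩ | ⟨⟨a⟩, ⟨b⟩⟩
  · exact .inl ⟨⟨e.trans a⟩, ⟨f.trans b⟩⟩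
  · exact .inr (.inl ⟨⟨e.trans a⟩, ⟨f.trans b⟩⟩)
  · exact .inr (.inr (.inl ⟨⟨e.trans a⟩, ⟨f.trans b⟩⟩))
  · exact .inr (.inr (.inr ⟨⟨e.trans a⟩, ⟨f.trans b⟩⟩))

end Classification

section Distinctness

open DihedralGroup

theorem isEmpty_dihedralGroup_eight_mulEquiv {G : Type*} [Group G] (h : ∀ g : G, g ^ 4 = 1) :
    IsEmpty (DihedralGroup 8 ≃* G) := by
  refine ⟨fun e => ?_⟩
  have hr : (r 1 : DihedralGroup 8) ^ 4 = 1 := e.injective (by rw [map_pow, h, map_one])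
  exact absurd hr (by decide)

theorem pow_four_cyc_two_prod_dihedralGroup (g : Cyc 2 × DihedralGroup 4) : g ^ 4 = 1 := by
  decide +revert

theorem pow_four_c4CentralD4 (g : C4CentralD4) : g ^ 4 = 1 := by
  obtain ⟨p, rfl⟩ := QuotientGroup.mk_surjective g
  have hp : ∀ p : Cyc 4 × DihedralGroup 4, p ^ 4 = 1 := by decide
  rw [← QuotientGroup.mk_pow, hp, QuotientGroup.mk_one]

theorem mem_amalgamatedCentre_iff {p : Cyc 4 × DihedralGroup 4} :
    p ∈ amalgamatedCentre ↔ p = 1 ∨ p = (Multiplicative.ofAdd 2, r 2) := by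
  have hz : ((Multiplicative.ofAdd 2, r 2) : Cyc 4 × DihedralGroup 4) ^ 2 = 1 := by decide
  constructor
  · rintro ⟨k, rfl⟩
    obtain ⟨l, rfl | rfl⟩ := Int.even_or_odd' k
    · exact .inl (by simp only [zpow_mul, zpow_ofNat, hz, one_zpow])
    · exact .inr (by simp only [zpow_add_one, zpow_mul, zpow_ofNat, hz, one_zpow, one_mul])
  · rintro (rfl | rfl)
    · exact one_mem _
    · exact Subgroup.mem_zpowers _

theorem c4CentralD4_mk_eq_mk_iff {p q : Cyc 4 × DihedralGroup 4} :
    (p : C4CentralD4) = q ↔ p⁻¹ * q = 1 ∨ p⁻¹ * q = (Multiplicative.ofAdd 2, r 2) := by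
  rw [QuotientGroup.eq, mem_amalgamatedCentre_iff]

/-- The centre of `C_2 × D_4` has exponent `2`, while that of `C_4 ∘ D_4` contains `C_4`. -/
theorem isEmpty_cyc_two_prod_dihedralGroup_mulEquiv_c4CentralD4 :
    IsEmpty ((Cyc 2 × DihedralGroup 4) ≃* C4CentralD4) := by
  refine ⟨fun e => ?_⟩
  let p : Cyc 4 × DihedralGroup 4 := (Multiplicative.ofAdd 1, 1)
  have hp_central : ∀ q, p * q = q * p := by decide
  have hu_central : ∀ g : C4CentralD4, (p : C4CentralD4) * g = g * p := by
    intro g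
    obtain ⟨q, rfl⟩ := QuotientGroup.mk_surjective g
    rw [← QuotientGroup.mk_mul, hp_central, QuotientGroup.mk_mul]
  have hcentre : ∀ g : Cyc 2 × DihedralGroup 4, (∀ h, g * h = h * g) → g * g = 1 := by decide
  have hu_sq : (p : C4CentralD4) * p = 1 := by
    have := hcentre (e.symm p) fun h => e.injective <| by
      rw [map_mul, map_mul, e.apply_symm_apply, hu_central]
    rwa [← map_mul, EmbeddingLike.map_eq_one_iff] at this
  rw [← QuotientGroup.mk_mul, QuotientGroup.eq_one_iff, mem_amalgamatedCentre_iff] at hu_sq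
  exact absurd hu_sq (by decide)

theorem isEmpty_cyc_four_prod_cyc_two_mulEquiv_dihedralGroup :
    IsEmpty ((Cyc 4 × Cyc 2) ≃* DihedralGroup 4) := by
  refine ⟨fun e => ?_⟩
  have hcomm (a b : DihedralGroup 4) : a * b = b * a :=
    e.symm.injective (by rw [map_mul, map_mul, mul_comm])
  exact absurd hcomm (by decide)

end Distinctness

/-- `G` is a nonabelian group of order `16` with a subgroup of index `2` isomorphic to `K` such
that `G` is generated by the involutions outside this subgroup. -/
def HasInvolutoryPair (G K : Type*) [Group G] [Group K] : Prop :=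
  Nat.card G = 16 ∧ (¬ ∀ a b : G, a * b = b * a) ∧
    ∃ H : Subgroup G, H.index = 2 ∧ Nonempty (H ≃* K) ∧ GeneratedByInvolutionsOutside H

namespace HasInvolutoryPair

variable {G K G' K' : Type*} [Group G] [Group K] [Group G'] [Group K']

theorem of_mulEquiv (h : HasInvolutoryPair G' K') (e : G ≃* G') (f : K ≃* K') :
    HasInvolutoryPair G K := by
  obtain ⟨hcard, hna, H, hH, ⟨g⟩, hgen⟩ := h
  refine ⟨(Nat.card_congr e.toEquiv).trans hcard, fun hcomm => hna fun a b => ?_,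
    H.map e.symm.toMonoidHom, (Subgroup.index_map_equiv H e.symm).trans hH,
    ⟨((H.equivMapOfInjective _ e.symm.injective).symm.trans g).trans f.symm⟩, ?_⟩
  · exact e.symm.injective (by rw [map_mul, map_mul, hcomm])
  · rw [GeneratedByInvolutionsOutside, eq_top_iff, ← Subgroup.map_top_of_surjective
      e.symm.toMonoidHom e.symm.surjective, ← hgen, MonoidHom.map_closure]
    refine Subgroup.closure_mono ?_
    rintro _ ⟨s, ⟨hsH, hs⟩, rfl⟩
    refine ⟨?_, (e.symm.orderOf_eq s).trans hs⟩
    rintro ⟨t, ht, hts⟩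
    exact hsH (e.symm.injective hts ▸ ht)

theorem isTablePair (h : HasInvolutoryPair G K) : IsTablePair G K := by
  obtain ⟨hcard, hna, H, hH, ⟨g⟩, hgen⟩ := h
  exact (isTablePair_of_generatedByInvolutionsOutside hcard hna hH hgen).of_mulEquiv
    (MulEquiv.refl G) g.symm

theorem of_injective (hG : Nat.card G = 16) (hna : ¬ ∀ a b : G, a * b = b * a)
    (hK : Nat.card K = 8) (f : K →* G) (hf : Function.Injective f) {S : Set G}
    (hgen : Subgroup.closure S = ⊤) (hS : ∀ s ∈ S, s ^ 2 = 1 ∧ ∀ k, f k ≠ s) :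
    HasInvolutoryPair G K := by
  let e : K ≃* f.range := f.ofInjective hf
  refine ⟨hG, hna, f.range,
    index_eq_two_of_card_eq_eight hG ((Nat.card_congr e.toEquiv).symm.trans hK), ⟨e.symm⟩, ?_⟩
  rw [GeneratedByInvolutionsOutside, eq_top_iff, ← hgen]
  refine Subgroup.closure_mono fun s hs => ⟨?_, orderOf_eq_prime (hS s hs).1 ?_⟩
  · rintro ⟨k, hk⟩
    exact (hS s hs).2 k hk
  · rintro rfl
    exact (hS 1 hs).2 1 (map_one f)

end HasInvolutoryPair

theorem closure_triple_eq_top_of_forall_exists {G : Type*} [Group G] {a b c : G} {l m n : ℕ}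
    (h : ∀ g, ∃ i : Fin l, ∃ j : Fin m, ∃ k : Fin n,
      g = (a * b) ^ (i : ℕ) * a ^ (j : ℕ) * c ^ (k : ℕ)) :
    Subgroup.closure {a, b, c} = ⊤ := by
  have ha : a ∈ Subgroup.closure {a, b, c} := Subgroup.subset_closure (by simp)
  have hb : b ∈ Subgroup.closure {a, b, c} := Subgroup.subset_closure (by simp)
  have hc : c ∈ Subgroup.closure {a, b, c} := Subgroup.subset_closure (by simp)
  rw [eq_top_iff]
  intro g _
  obtain ⟨i, j, k, rfl⟩ := h g
  exact mul_mem (mul_mem (pow_mem (mul_mem ha hb) _) (pow_mem ha _)) (pow_mem hc _)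

section Realizations

open DihedralGroup

theorem hasInvolutoryPair_dihedralGroup_eight_cyc :
    HasInvolutoryPair (DihedralGroup 8) (Cyc 8) := by
  let f : Cyc 8 →* DihedralGroup 8 := MonoidHom.mk' (fun i => r i.toAdd) fun _ _ => rfl
  have hgen : Subgroup.closure {(sr 0 : DihedralGroup 8), sr 1, sr 0} = ⊤ :=
    closure_triple_eq_top_of_forall_exists (l := 8) (m := 2) (n := 1) (by decide)
  refine .of_injective nat_card (by decide) (card_cyc 8) f (fun _ _ => r.inj) hgen ?_
  rintro _ (rfl | rfl | rfl) <;> decide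

theorem card_cyc_two_prod_dihedralGroup : Nat.card (Cyc 2 × DihedralGroup 4) = 16 := by
  rw [Nat.card_prod, card_cyc, nat_card]

theorem hasInvolutoryPair_cyc_two_prod_dihedralGroup_cyc :
    HasInvolutoryPair (Cyc 2 × DihedralGroup 4) (Cyc 4 × Cyc 2) := by
  let f : Cyc 4 × Cyc 2 →* Cyc 2 × DihedralGroup 4 :=
    MonoidHom.mk' (fun p => (p.2, r p.1.toAdd)) fun _ _ => rfl
  have hgen : Subgroup.closure {((1, sr 0) : Cyc 2 × DihedralGroup 4), (1, sr 1),
      (Multiplicative.ofAdd 1, sr 0)} = ⊤ :=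
    closure_triple_eq_top_of_forall_exists (l := 4) (m := 2) (n := 2) (by decide)
  refine .of_injective card_cyc_two_prod_dihedralGroup (by decide) ?_ f (by decide) hgen ?_
  · rw [Nat.card_prod, card_cyc, card_cyc]
  · rintro _ (rfl | rfl | rfl) <;> decide

theorem hasInvolutoryPair_cyc_two_prod_dihedralGroup_dihedralGroup :
    HasInvolutoryPair (Cyc 2 × DihedralGroup 4) (DihedralGroup 4) := by
  let f : DihedralGroup 4 →* Cyc 2 × DihedralGroup 4 := MonoidHom.mk' (fun
    | r i => (1, r i)
    | sr i => (Multiplicative.ofAdd 1, sr i)) (by decide)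
  have hgen : Subgroup.closure {((1, sr 0) : Cyc 2 × DihedralGroup 4), (1, sr 1),
      (Multiplicative.ofAdd 1, 1)} = ⊤ :=
    closure_triple_eq_top_of_forall_exists (l := 4) (m := 2) (n := 2) (by decide)
  refine .of_injective card_cyc_two_prod_dihedralGroup (by decide) nat_card f (by decide) hgen ?_
  rintro _ (rfl | rfl | rfl) <;> decide

/-- A section of the embedding `Q_8 → C_4 ∘ D_4`, whose image is generated by the classes of
`(1, r 1)` and `(i, sr 0)` with `i` of order `4` in `C_4`. -/
def quaternionSection : QuaternionGroup 2 → Cyc 4 × DihedralGroup 4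
  | .a i => (1, r i)
  | .xa i => (Multiplicative.ofAdd 1, sr i)

/-- The embedding of `Q_8` into `C_4 ∘ D_4` induced by `quaternionSection`. -/
def quaternionEmbedding : QuaternionGroup 2 →* C4CentralD4 :=
  MonoidHom.mk' (fun d => quaternionSection d) fun a b => by
    rw [← QuotientGroup.mk_mul, c4CentralD4_mk_eq_mk_iff]
    decide +revert

theorem quaternionEmbedding_injective : Function.Injective quaternionEmbedding := by
  intro a b hab
  have h : ∀ a b, (quaternionSection a)⁻¹ * quaternionSection b = 1 ∨
      (quaternionSection a)⁻¹ * quaternionSection b = (Multiplicative.ofAdd 2, r 2) → a = b := by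
    decide
  exact h a b (c4CentralD4_mk_eq_mk_iff.mp hab)

theorem not_forall_mul_comm_c4CentralD4 : ¬ ∀ a b : C4CentralD4, a * b = b * a := fun hcomm => by
  have h := hcomm ((1, r 1) : Cyc 4 × DihedralGroup 4) ((1, sr 0) : Cyc 4 × DihedralGroup 4)
  rw [← QuotientGroup.mk_mul, ← QuotientGroup.mk_mul, c4CentralD4_mk_eq_mk_iff] at h
  exact absurd h (by decide)

theorem closure_involutions_c4CentralD4 :
    Subgroup.closure (QuotientGroup.mk' amalgamatedCentre ''
      {(1, sr 0), (1, sr 1), (Multiplicative.ofAdd 1, r 1)}) = ⊤ := by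
  have hgen : Subgroup.closure {((1, sr 0) : Cyc 4 × DihedralGroup 4), (1, sr 1),
      (Multiplicative.ofAdd 1, r 1)} = ⊤ :=
    closure_triple_eq_top_of_forall_exists (l := 4) (m := 2) (n := 4) (by decide +kernel)
  rw [← MonoidHom.map_closure, hgen,
    Subgroup.map_top_of_surjective _ (QuotientGroup.mk'_surjective _)]

theorem hasInvolutoryPair_c4CentralD4_quaternionGroup :
    HasInvolutoryPair C4CentralD4 (QuaternionGroup 2) := by
  have hcard : Nat.card (QuaternionGroup 2) = 8 := by
    rw [Nat.card_eq_fintype_card, QuaternionGroup.card]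
  refine .of_injective card_c4CentralD4 not_forall_mul_comm_c4CentralD4 hcard
    quaternionEmbedding quaternionEmbedding_injective closure_involutions_c4CentralD4 ?_
  rintro _ ⟨p, hp, rfl⟩
  refine ⟨?_, fun k hk => ?_⟩
  · rw [← map_pow, QuotientGroup.mk'_apply, QuotientGroup.eq_one_iff, mem_amalgamatedCentre_iff]
    rcases hp with rfl | rfl | rfl <;> decide
  · replace hk := c4CentralD4_mk_eq_mk_iff.mp hk
    rcases hp with rfl | rfl | rfl <;> exact absurd hk (by decide +revert)

end Realizations

theorem hasInvolutoryPair_iff_isTablePair {G K : Type*} [Group G] [Group K] :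
    HasInvolutoryPair G K ↔ IsTablePair G K := by
  refine ⟨HasInvolutoryPair.isTablePair, ?_⟩
  rintro (⟨⟨e⟩, ⟨f⟩⟩ | ⟨⟨e⟩, ⟨f⟩⟩ | ⟨⟨e⟩, ⟨f⟩⟩ | ⟨⟨e⟩, ⟨f⟩⟩)
  · exact hasInvolutoryPair_dihedralGroup_eight_cyc.of_mulEquiv e f
  · exact hasInvolutoryPair_cyc_two_prod_dihedralGroup_cyc.of_mulEquiv e f
  · exact hasInvolutoryPair_cyc_two_prod_dihedralGroup_dihedralGroup.of_mulEquiv e f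
  · exact hasInvolutoryPair_c4CentralD4_quaternionGroup.of_mulEquiv e f

section FinitelyGenerated

open Module

theorem finrank_range_add_finrank_ker_of_isDomain {R M M' : Type*} [CommRing R] [IsDomain R]
    [AddCommGroup M] [Module R M] [Module.Finite R M] [AddCommGroup M'] [Module R M']
    (f : M →ₗ[R] M') :
    finrank R (LinearMap.range f) + finrank R (LinearMap.ker f) = finrank R M := by
  rw [← f.quotKerEquivRange.finrank_eq, Submodule.finrank_quotient_add_finrank]

theorem finrank_prod_of_isDomain (R M M' : Type*) [CommRing R] [IsDomain R]
    [AddCommGroup M] [Module R M] [Module.Finite R M]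
    [AddCommGroup M'] [Module R M'] [Module.Finite R M'] :
    finrank R (M × M') = finrank R M + finrank R M' := by
  rw [← finrank_range_add_finrank_ker_of_isDomain (LinearMap.fst R M M'), LinearMap.ker_fst,
    LinearMap.finrank_range_of_inj LinearMap.inr_injective,
    LinearMap.range_eq_top.mpr LinearMap.fst_surjective, finrank_top]

theorem finrank_int_eq_zero_of_finite (T : Type*) [AddCommGroup T] [_root_.Finite T] :
    finrank ℤ T = 0 := by
  rw [finrank_eq_zero_iff_isTorsion]
  refine fun {t} => ⟨⟨Nat.card T, mem_nonZeroDivisors_of_ne_zero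
    (Nat.cast_ne_zero.mpr Nat.card_pos.ne')⟩, ?_⟩
  exact (natCast_zsmul t _).trans card_nsmul_eq_zero'

theorem exists_addEquiv_int_pi_prod_finite (M : Type*) [AddCommGroup M] [Module.Finite ℤ M] :
    ∃ (n : ℕ) (T : Type) (_ : AddCommGroup T) (_ : _root_.Finite T),
      Nonempty (M ≃+ (Fin n → ℤ) × T) := by
  classical
  have : AddGroup.FG M := Module.Finite.iff_addGroup_fg.mp inferInstance
  obtain ⟨n, ι, _, p, hp, e, ⟨f⟩⟩ := AddCommGroup.equiv_free_prod_directSum_zmod M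
  have (i : ι) : NeZero (p i ^ e i) := ⟨pow_ne_zero _ (hp i).ne_zero⟩
  exact ⟨n, ∀ i, ZMod (p i ^ e i), inferInstance, inferInstance,
    ⟨f.trans ((Finsupp.linearEquivFunOnFinite ℤ ℤ (Fin n)).toAddEquiv.prodCongr
      (DirectSum.addEquivProd _))⟩⟩

theorem index_range_nsmul_prod (A B : Type*) [AddCommGroup A] [AddCommGroup B] (k : ℕ) :
    (nsmulAddMonoidHom (α := A × B) k).range.index =
      (nsmulAddMonoidHom (α := A) k).range.index * (nsmulAddMonoidHom (α := B) k).range.index := by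
  rw [← AddSubgroup.index_prod, ← AddMonoidHom.range_prodMap]
  rfl

theorem card_ker_nsmul_prod (A B : Type*) [AddCommGroup A] [AddCommGroup B] (k : ℕ) :
    Nat.card (nsmulAddMonoidHom (α := A × B) k).ker =
      Nat.card (nsmulAddMonoidHom (α := A) k).ker *
        Nat.card (nsmulAddMonoidHom (α := B) k).ker := by
  rw [← Nat.card_prod, ← Nat.card_congr (AddSubgroup.prodEquiv _ _).toEquiv,
    ← AddMonoidHom.ker_prodMap]
  rfl

theorem index_range_nsmul_congr {A B : Type*} [AddCommGroup A] [AddCommGroup B] (e : A ≃+ B)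
    (k : ℕ) : (nsmulAddMonoidHom (α := A) k).range.index =
      (nsmulAddMonoidHom (α := B) k).range.index := by
  rw [← AddSubgroup.index_map_equiv _ e]
  exact congrArg _ (AddEquiv.map_range_nsmulAddMonoidHom e k)

theorem card_ker_nsmul_congr {A B : Type*} [AddCommGroup A] [AddCommGroup B] (e : A ≃+ B)
    (k : ℕ) : Nat.card (nsmulAddMonoidHom (α := A) k).ker =
      Nat.card (nsmulAddMonoidHom (α := B) k).ker := by
  refine Nat.card_congr (e.toEquiv.subtypeEquiv fun a => ?_)
  change k • a = 0 ↔ k • e a = 0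
  rw [← map_nsmul, EmbeddingLike.map_eq_zero_iff]

theorem index_range_nsmul_of_finite_int (M : Type*) [AddCommGroup M] [Module.Finite ℤ M] {k : ℕ}
    (hk : k ≠ 0) : (nsmulAddMonoidHom (α := M) k).range.index =
      k ^ finrank ℤ M * Nat.card (nsmulAddMonoidHom (α := M) k).ker := by
  obtain ⟨n, T, _, _, ⟨e⟩⟩ := exists_addEquiv_int_pi_prod_finite M
  have hker : (nsmulAddMonoidHom (α := Fin n → ℤ) k).ker = ⊥ :=
    (AddMonoidHom.ker_eq_bot_iff _).mpr
      (AddSubgroup.nsmulAddMonoidHom_injective_of_isTorsionFree hk)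
  rw [index_range_nsmul_congr e, card_ker_nsmul_congr e, e.toIntLinearEquiv.finrank_eq,
    index_range_nsmul_prod, card_ker_nsmul_prod, finrank_prod_of_isDomain,
    AddSubgroup.index_range_nsmul, AddSubgroup.index_range (f := nsmulAddMonoidHom (α := T) k),
    finrank_int_eq_zero_of_finite T, hker, AddSubgroup.card_bot, one_mul, add_zero]

end FinitelyGenerated

section Involution

open Module

variable {E : Type*} [AddCommGroup E] {σ : E →ₗ[ℤ] E}

theorem mem_ker_sub_id {x : E} : x ∈ LinearMap.ker (σ - LinearMap.id) ↔ σ x = x := by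
  rw [LinearMap.mem_ker, LinearMap.sub_apply, sub_eq_zero, LinearMap.id_apply]

theorem mem_ker_add_id {x : E} : x ∈ LinearMap.ker (σ + LinearMap.id) ↔ σ x = -x := by
  rw [LinearMap.mem_ker, LinearMap.add_apply, add_eq_zero_iff_eq_neg, LinearMap.id_apply]

theorem finrank_le_finrank_ker_sub_id_add_finrank_ker_add_id [Module.Finite ℤ E]
    (hσ : ∀ x, σ (σ x) = x) :
    finrank ℤ E ≤ finrank ℤ (LinearMap.ker (σ - LinearMap.id)) +
      finrank ℤ (LinearMap.ker (σ + LinearMap.id)) := by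
  rw [← finrank_range_add_finrank_ker_of_isDomain (σ + LinearMap.id)]
  gcongr
  apply Submodule.finrank_mono
  rintro _ ⟨x, rfl⟩
  rw [mem_ker_sub_id, LinearMap.add_apply, LinearMap.id_apply, map_add, hσ, add_comm]

theorem card_ker_nsmul_submodule {k : ℕ} {C : Submodule ℤ E} (hC : ∀ x, k • x = 0 → x ∈ C) :
    Nat.card (nsmulAddMonoidHom (α := C) k).ker = Nat.card (nsmulAddMonoidHom (α := E) k).ker :=
  Nat.card_congr
    { toFun := fun x => ⟨x.1, congrArg Subtype.val x.2⟩
      invFun := fun x => ⟨⟨x.1, hC x.1 x.2⟩, Subtype.ext x.2⟩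
      left_inv := fun _ => rfl
      right_inv := fun _ => rfl }

/-- The hypothesis `h` says that `H¹` vanishes, so that every negated element is some `σ x - x`.
If `σ x + x` is the double of a fixed `a`, then `σ x - x` is the double of the negated `a - x`. -/
theorem index_range_two_nsmul_ker_add_id_dvd (hσ : ∀ x, σ (σ x) = x)
    (h : ∀ x, σ x = -x → ∃ y, σ y - y = x) :
    (nsmulAddMonoidHom (α := LinearMap.ker (σ + LinearMap.id)) 2).range.index ∣
      (nsmulAddMonoidHom (α := LinearMap.ker (σ - LinearMap.id)) 2).range.index := by
  let N : E →+ LinearMap.ker (σ - LinearMap.id) :=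
    ((σ + LinearMap.id).codRestrict _ fun x => by
      rw [mem_ker_sub_id]; simp [hσ, add_comm]).toAddMonoidHom
  let d : E →+ LinearMap.ker (σ + LinearMap.id) :=
    ((σ - LinearMap.id).codRestrict _ fun x => by
      rw [mem_ker_add_id]; simp [hσ]).toAddMonoidHom
  have hd : Function.Surjective d := fun b =>
    (h b (mem_ker_add_id.mp b.2)).imp fun _ hy => Subtype.ext hy
  have hle : (nsmulAddMonoidHom 2).range.comap N ≤ (nsmulAddMonoidHom 2).range.comap d := by
    rintro x ⟨a, ha⟩
    have ha' : a.1 + a.1 = σ x + x := (two_nsmul a.1).symm.trans (congrArg Subtype.val ha)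
    have hb : a.1 - x ∈ LinearMap.ker (σ + LinearMap.id) := by
      rw [mem_ker_add_id, map_sub, mem_ker_sub_id.mp a.2, neg_sub,
        sub_eq_sub_iff_add_eq_add, ha', add_comm]
    refine ⟨⟨a.1 - x, hb⟩, Subtype.ext ((two_nsmul (a.1 - x)).trans ?_)⟩
    rw [sub_add_sub_comm, ha', add_sub_add_right_eq_sub]
    rfl
  rw [← AddSubgroup.index_comap_of_surjective _ hd]
  refine (AddSubgroup.index_dvd_of_le hle).trans ?_
  rw [AddSubgroup.index_comap]
  exact AddSubgroup.relIndex_dvd_index_of_normal _ _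

theorem exists_map_eq_neg_and_forall_sub_ne [Module.Finite ℤ E] (hσ : ∀ x, σ (σ x) = x)
    (htors : ∀ x, 2 • x = 0 → σ x = x)
    (hrank : 2 * finrank ℤ (LinearMap.ker (σ - LinearMap.id)) < finrank ℤ E) :
    ∃ x, σ x = -x ∧ ∀ y, σ y - y ≠ x := by
  by_contra! h
  have hdvd := index_range_two_nsmul_ker_add_id_dvd hσ h
  have hneg (x : E) (hx : 2 • x = 0) : x ∈ LinearMap.ker (σ + LinearMap.id) := by
    rw [mem_ker_add_id, htors x hx, eq_neg_iff_add_eq_zero, ← two_nsmul, hx]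
  have hpos : 0 < Nat.card (nsmulAddMonoidHom (α := E) 2).ker := by
    have : AddGroup.FG E := Module.Finite.iff_addGroup_fg.mp inferInstance
    have := AddSubgroup.finiteIndex_range_nsmulAddMonoidHom_of_fg E two_ne_zero
    rw [Nat.pos_iff_ne_zero]
    refine right_ne_zero_of_mul (a := 2 ^ finrank ℤ E) ?_
    rw [← index_range_nsmul_of_finite_int E two_ne_zero]
    exact AddSubgroup.FiniteIndex.index_ne_zero
  rw [index_range_nsmul_of_finite_int _ two_ne_zero, index_range_nsmul_of_finite_int _ two_ne_zero,
    card_ker_nsmul_submodule hneg, card_ker_nsmul_submodule fun x hx =>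
      mem_ker_sub_id.mpr (htors x hx), Nat.mul_dvd_mul_iff_right hpos,
    Nat.pow_dvd_pow_iff_le_right one_lt_two] at hdvd
  have := finrank_le_finrank_ker_sub_id_add_finrank_ker_add_id hσ
  omega

end Involution

section InvariantIdeals

open Ideal Pointwise UniqueFactorizationMonoid

variable {A B G : Type*} [CommRing A] [CommRing B] [Algebra A B] [Group G] [MulSemiringAction G B]

theorem smul_map_algebraMap [SMulCommClass G A B] (g : G) (I : Ideal A) :
    g • I.map (algebraMap A B) = I.map (algebraMap A B) := by
  rw [pointwise_smul_def, map_map]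
  congr 1
  ext x
  exact smul_algebraMap g x

variable [IsDedekindDomain A] [IsDedekindDomain B] [Module.Finite A B] [Module.IsTorsionFree A B]

theorem squarefree_map_of_isUnramifiedAt (p : Ideal A) [p.IsMaximal] (hp : p ≠ ⊥)
    (h : ∀ (P : Ideal B) [P.IsPrime] [P.LiesOver p], Algebra.IsUnramifiedAt A P) :
    Squarefree (p.map (algebraMap A B)) := by
  classical
  have hp' : p.map (algebraMap A B) ≠ ⊥ := map_ne_bot_of_ne_bot hp
  rw [squarefree_iff_nodup_normalizedFactors hp', Multiset.nodup_iff_count_le_one]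
  intro P
  by_cases hP : P ∈ normalizedFactors (p.map (algebraMap A B))
  · obtain ⟨_, _⟩ := (mem_primesOver_iff_mem_normalizedFactors B hp).mpr hP
    have := h P
    rw [← IsDedekindDomain.ramificationIdx_eq_normalizedFactors_count p P hp',
      ramificationIdx_eq_one]
  · rw [Multiset.count_eq_zero_of_notMem hP]
    exact zero_le_one

variable [Finite G] [IsGaloisGroup G A B]

theorem map_under_dvd_of_invariant {I P : Ideal B} [P.IsMaximal]
    (hun : ∀ (Q : Ideal B) [Q.IsPrime], Q ≠ ⊥ → Algebra.IsUnramifiedAt A Q) (hI0 : I ≠ ⊥)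
    (hI : ∀ g : G, g • I = I) (hIP : I ≤ P) : (P.under A).map (algebraMap A B) ∣ I := by
  classical
  have hp0 : P.under A ≠ ⊥ := mt eq_bot_of_comap_eq_bot (ne_bot_of_le_ne_bot hI0 hIP)
  have hp' : (P.under A).map (algebraMap A B) ≠ ⊥ := map_ne_bot_of_ne_bot hp0
  have : (P.under A).IsMaximal := IsMaximal.under _ P
  have hsq : Squarefree ((P.under A).map (algebraMap A B)) :=
    squarefree_map_of_isUnramifiedAt _ hp0 fun Q => hun Q (ne_bot_of_liesOver_of_ne_bot hp0 Q)
  rw [dvd_iff_normalizedFactors_le_normalizedFactors hp' hI0,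
    Multiset.le_iff_subset ((squarefree_iff_nodup_normalizedFactors hp').mp hsq)]
  intro Q hQ
  obtain ⟨hQprime, _⟩ := (mem_primesOver_iff_mem_normalizedFactors B hp0).mpr hQ
  obtain ⟨g, rfl⟩ := exists_smul_eq_of_isGaloisGroup (P.under A) P Q G
  refine (Ideal.mem_normalizedFactors_iff hI0).mpr ⟨hQprime, ?_⟩
  rw [← hI g]
  exact pointwise_smul_le_pointwise_smul_iff.mpr hIP

theorem exists_eq_map_of_invariant
    (hun : ∀ (Q : Ideal B) [Q.IsPrime], Q ≠ ⊥ → Algebra.IsUnramifiedAt A Q)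
    {I : Ideal B} (hI0 : I ≠ ⊥) (hI : ∀ g : G, g • I = I) :
    ∃ J : Ideal A, I = J.map (algebraMap A B) := by
  induction I using IsNoetherian.induction with
  | hgt I ih =>
  by_cases htop : I = ⊤
  · exact ⟨⊤, by rw [htop, Ideal.map_top]⟩
  obtain ⟨P, hP, hIP⟩ := exists_le_maximal I htop
  have hPtop : (P.under A).map (algebraMap A B) ≠ ⊤ := ne_top_of_le_ne_top hP.ne_top map_comap_le
  obtain ⟨J, rfl⟩ := map_under_dvd_of_invariant hun hI0 hI hIP
  have hp0 : (P.under A).map (algebraMap A B) ≠ ⊥ := left_ne_zero_of_mul hI0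
  have hJ0 : J ≠ ⊥ := right_ne_zero_of_mul hI0
  have hlt : (P.under A).map (algebraMap A B) * J < J :=
    lt_of_le_of_ne Ideal.mul_le_right fun h =>
      hPtop (((mul_eq_right₀ hJ0).mp h).trans one_eq_top)
  obtain ⟨J', rfl⟩ := ih J hlt hJ0 fun g => by
    have := hI g
    rw [smul_mul', smul_map_algebraMap] at this
    exact mul_left_cancel₀ hp0 this
  exact ⟨P.under A * J', (Ideal.map_mul _ _ _).symm⟩

end InvariantIdeals

section UnitsAction

open Module

variable {B G : Type*} [CommRing B] [Group G] [MulSemiringAction G B]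

/-- The action of `g` on the unit group of `B`, written additively so that it is `ℤ`-linear. -/
def unitsAction (g : G) : Additive Bˣ →ₗ[ℤ] Additive Bˣ :=
  (MonoidHom.toAdditive (Units.map (MulSemiringAction.toRingHom G B g : B →* B))).toIntLinearMap

theorem unitsAction_eq_iff {g : G} {u v : Additive Bˣ} :
    unitsAction g u = v ↔ g • (u.toMul : B) = v.toMul := by
  rw [← Additive.toMul.injective.eq_iff, Units.ext_iff]
  rfl

theorem unitsAction_unitsAction {g : G} (hg : g * g = 1) (u : Additive Bˣ) :
    unitsAction g (unitsAction g u) = u := by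
  have := unitsAction_eq_iff.mp (rfl : unitsAction g u = _)
  rw [unitsAction_eq_iff, ← this, smul_smul, hg, one_smul]

theorem unitsAction_eq_self_of_two_nsmul_eq_zero [IsDomain B] (g : G) {u : Additive Bˣ}
    (hu : 2 • u = 0) : unitsAction g u = u := by
  have hsq : (u.toMul : B) * u.toMul = 1 := by
    rw [← Units.val_mul, ← toMul_add, ← two_nsmul, hu, toMul_zero, Units.val_one]
  rw [unitsAction_eq_iff]
  rcases mul_self_eq_one_iff.mp hsq with h | h <;> rw [h]
  · exact smul_one g
  · rw [smul_neg, smul_one]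

theorem finrank_ker_unitsAction_sub_id {A : Type*} [CommRing A] [Algebra A B] [FaithfulSMul A B]
    [Finite G] [IsGaloisGroup G A B] {g : G} (hg : Subgroup.zpowers g = ⊤) :
    finrank ℤ (LinearMap.ker (unitsAction g - LinearMap.id : Additive Bˣ →ₗ[ℤ] Additive Bˣ)) =
      finrank ℤ (Additive Aˣ) := by
  let i : Additive Aˣ →ₗ[ℤ] Additive Bˣ :=
    (MonoidHom.toAdditive (Units.map (algebraMap A B : A →* B))).toIntLinearMap
  have hi : Function.Injective i := Units.map_injective (FaithfulSMul.algebraMap_injective A B)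
  suffices LinearMap.ker (unitsAction g - LinearMap.id) = LinearMap.range i by
    rw [this, LinearMap.finrank_range_of_inj hi]
  ext u
  rw [mem_ker_sub_id, unitsAction_eq_iff]
  constructor
  · intro hu
    have hfix (h : G) : h • (u.toMul : B) = u.toMul := by
      have hle : Subgroup.zpowers g ≤ MulAction.stabilizer G (u.toMul : B) :=
        Subgroup.zpowers_le.mpr hu
      exact hle (hg ▸ Subgroup.mem_top h)
    obtain ⟨y, hy⟩ := Algebra.IsInvariant.isInvariant (A := A) (u.toMul : B) hfix
    have : Algebra.IsIntegral A B := Algebra.IsInvariant.isIntegral A B G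
    have hunit : IsUnit y := isUnit_of_map_unit (algebraMap A B) y (hy ▸ u.toMul.isUnit)
    exact ⟨Additive.ofMul hunit.unit, Additive.toMul.injective (Units.ext hy)⟩
  · rintro ⟨v, rfl⟩
    exact smul_algebraMap g _

end UnitsAction

/-- Hilbert's Theorem 90 for an involution: `1 + g • e` works unless it vanishes. -/
theorem exists_smul_eq_mul_of_smul_mul_eq_one {B G : Type*} [CommRing B] [Group G]
    [MulSemiringAction G B] {g : G} (hg : g * g = 1) (hne : ∃ x : B, g • x ≠ x) {e : B}
    (he : e * g • e = 1) : ∃ a : B, a ≠ 0 ∧ g • a = e * a := by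
  have hgg (x : B) : g • g • x = x := by rw [smul_smul, hg, one_smul]
  by_cases h : 1 + g • e = 0
  · obtain ⟨x, hx⟩ := hne
    have he1 : e = -1 := by
      rw [← hgg e, eq_neg_of_add_eq_zero_right h, smul_neg, smul_one]
    refine ⟨x - g • x, sub_ne_zero.mpr hx.symm, ?_⟩
    rw [smul_sub, hgg, he1]
    ring
  · refine ⟨1 + g • e, h, ?_⟩
    rw [smul_add, smul_one, hgg, mul_add, mul_one, he, add_comm]

section PrincipalExtension

open Ideal

variable {A B : Type*} [CommRing A] [CommRing B] [Algebra A B]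
  {J : Ideal A} {a : B}

theorem isPrincipal_pow_finrank_of_map_eq_span_singleton [IsDedekindDomain A] [IsDedekindDomain B]
    [Module.Finite A B] [Module.IsTorsionFree A B] (hJ : J.map (algebraMap A B) = span {a}) :
    (J ^ Module.finrank A B).IsPrincipal := by
  rw [← relNorm_algebraMap B J, hJ, relNorm_singleton]
  exact ⟨_, rfl⟩

theorem not_isPrincipal_of_map_eq_span_singleton [IsDomain B] {G : Type*} [Group G]
    [MulSemiringAction G B] [SMulCommClass G A B] {g : G} {e : B} (ha0 : a ≠ 0) (ha : g • a = e * a)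
    (he : ∀ u : Bˣ, g • (u : B) ≠ e * u) (hJ : J.map (algebraMap A B) = span {a}) :
    ¬ J.IsPrincipal := by
  rintro ⟨b, rfl⟩
  rw [submodule_span_eq, map_span, Set.image_singleton, span_singleton_eq_span_singleton] at hJ
  obtain ⟨u, rfl⟩ := hJ
  refine he u (mul_left_cancel₀ (left_ne_zero_of_mul ha0) ?_)
  rw [smul_mul', smul_algebraMap] at ha
  rw [ha]
  ring

end PrincipalExtension

section QuadraticClassNumber

open NumberField Ideal Pointwise Module

variable {F K : Type*} [Field F] [NumberField F] [Field K] [NumberField K] [Algebra F K]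
  [IsGalois F K]

theorem exists_unit_smul_mul_eq_one_and_forall_smul_ne [IsUnramifiedAtInfinitePlaces F K]
    (h2 : finrank F K = 2) {τ : Gal(K/F)} (hτ : Subgroup.zpowers τ = ⊤) (hτ2 : τ * τ = 1) :
    ∃ ε : (𝓞 K)ˣ, (ε * τ • ε : 𝓞 K) = 1 ∧ ∀ η : (𝓞 K)ˣ, τ • (η : 𝓞 K) ≠ ε * η := by
  have := IsGaloisGroup.of_isFractionRing Gal(K/F) (𝓞 F) (𝓞 K) F K
  have hrank : 2 * finrank ℤ (Additive (𝓞 F)ˣ) < finrank ℤ (Additive (𝓞 K)ˣ) := by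
    rw [Units.finrank_eq, Units.finrank_eq, Units.rank, Units.rank,
      IsUnramifiedAtInfinitePlaces.card_infinitePlace F K, h2]
    have : 0 < Fintype.card (InfinitePlace F) := Fintype.card_pos
    omega
  rw [← finrank_ker_unitsAction_sub_id (B := 𝓞 K) hτ] at hrank
  have hτinv : ∀ u : Additive (𝓞 K)ˣ, unitsAction τ (unitsAction τ u) = u :=
    unitsAction_unitsAction hτ2
  have htors : ∀ u : Additive (𝓞 K)ˣ, 2 • u = 0 → unitsAction τ u = u := fun _ =>
    unitsAction_eq_self_of_two_nsmul_eq_zero τ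
  obtain ⟨x, hx, hne⟩ := exists_map_eq_neg_and_forall_sub_ne hτinv htors hrank
  refine ⟨x.toMul, ?_, fun η hη => hne (Additive.ofMul η) ?_⟩
  · rw [unitsAction_eq_iff.mp hx, toMul_neg, Units.mul_inv]
  · rw [sub_eq_iff_eq_add, unitsAction_eq_iff]
    exact hη

theorem exists_ideal_not_isPrincipal_sq_isPrincipal [IsUnramifiedAtInfinitePlaces F K]
    (h2 : finrank F K = 2) (hun : UnramifiedAtFinitePrimes F K) :
    ∃ J : Ideal (𝓞 F), ¬ J.IsPrincipal ∧ (J ^ 2).IsPrincipal := by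
  have hgal := IsGaloisGroup.of_isFractionRing Gal(K/F) (𝓞 F) (𝓞 K) F K
  have hcard : Nat.card Gal(K/F) = 2 := (IsGalois.card_aut_eq_finrank F K).trans h2
  obtain ⟨τ, hτ1, -⟩ := (Nat.card_eq_two_iff' (1 : Gal(K/F))).mp hcard
  have hτ : Subgroup.zpowers τ = ⊤ := zpowers_eq_top_of_prime_card hcard hτ1
  have hτ2 : τ * τ = 1 := by rw [← sq, ← hcard, pow_card_eq_one']
  have hmove : ∃ x : 𝓞 K, τ • x ≠ x := by
    by_contra! hfix
    exact hτ1 (hgal.faithful.eq_of_smul_eq_smul fun x => by rw [hfix, one_smul])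
  obtain ⟨ε, hε, hne⟩ := exists_unit_smul_mul_eq_one_and_forall_smul_ne h2 hτ hτ2
  obtain ⟨a, ha0, ha⟩ := exists_smul_eq_mul_of_smul_mul_eq_one hτ2 hmove hε
  have hspan : τ • span {a} = span {a} := by
    rw [smul_closure, Set.smul_set_singleton, ha, mul_comm,
      span_singleton_mul_right_unit ε.isUnit]
  have hinv (g : Gal(K/F)) : g • span {a} = span {a} := by
    have hle : Subgroup.zpowers τ ≤ MulAction.stabilizer Gal(K/F) (span {a}) :=
      Subgroup.zpowers_le.mpr hspan
    exact hle (hτ ▸ Subgroup.mem_top g)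
  obtain ⟨J, hJ⟩ := exists_eq_map_of_invariant hun (by simpa using ha0) hinv
  refine ⟨J, not_isPrincipal_of_map_eq_span_singleton ha0 ha hne hJ.symm, ?_⟩
  rw [← h2, IsFractionRing.finrank_eq (𝓞 F) F (𝓞 K) K]
  exact isPrincipal_pow_finrank_of_map_eq_span_singleton hJ.symm

theorem even_classNumber_of_unramified_quadratic [IsUnramifiedAtInfinitePlaces F K]
    (h2 : finrank F K = 2) (hun : UnramifiedAtFinitePrimes F K) : Even (classNumber F) := by
  obtain ⟨J, hJ, hJ2⟩ := exists_ideal_not_isPrincipal_sq_isPrincipal h2 hun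
  have hJ0 : J ≠ ⊥ := fun h => hJ (h ▸ bot_isPrincipal)
  let J' : nonZeroDivisors (Ideal (𝓞 F)) := ⟨J, mem_nonZeroDivisors_of_ne_zero hJ0⟩
  have horder : orderOf (ClassGroup.mk0 J') = 2 := by
    refine orderOf_eq_prime ?_ fun h => hJ ((ClassGroup.mk0_eq_one_iff _).mp h)
    rw [← map_pow, ClassGroup.mk0_eq_one_iff]
    exact hJ2
  rw [even_iff_two_dvd, classNumber, ← horder]
  exact orderOf_dvd_card

end QuadraticClassNumber

section Ramification

open NumberField Ideal Pointwise

theorem card_inertia_eq_ramificationIdx {E L G : Type*} [Field E] [NumberField E] [Field L]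
    [NumberField L] [Algebra E L] [Group G] [Finite G] [MulSemiringAction G L]
    [IsGaloisGroup G E L] (P : Ideal (𝓞 L)) [P.IsPrime] :
    Nat.card (P.inertia G) = P.ramificationIdx (𝓞 E) := by
  have := IsGaloisGroup.of_isFractionRing G (𝓞 E) (𝓞 L) E L
  rw [card_inertia_eq_ramificationIdxIn (P.under (𝓞 E)) P,
    ramificationIdxIn_eq_ramificationIdx (P.under (𝓞 E)) P G]

variable {F L : Type*} [Field F] [Field L] [Algebra F L]

theorem card_inertia_inf_eq_ramificationIdx [NumberField F] [NumberField L] (N : Subgroup Gal(L/F))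
    (E : IntermediateField F L) [IsGaloisGroup N E L] (P : Ideal (𝓞 L)) [P.IsPrime] :
    Nat.card (P.inertia Gal(L/F) ⊓ N : Subgroup Gal(L/F)) = P.ramificationIdx (𝓞 E) := by
  rw [← card_inertia_eq_ramificationIdx (G := N), ← AddSubgroup.inertia_map_subtype]
  exact (Nat.card_congr (Subgroup.equivMapOfInjective _ _ N.subtype_injective).toEquiv).symm

theorem inertia_inf_fixingSubgroup_eq_bot [NumberField F] [NumberField L] [IsGalois F L]
    (k : IntermediateField F L) (P : Ideal (𝓞 L)) [P.IsPrime]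
    (h : Algebra.IsUnramifiedAt (𝓞 k) P) :
    P.inertia Gal(L/F) ⊓ k.fixingSubgroup = ⊥ := by
  have : IsGaloisGroup k.fixingSubgroup k L := IsGaloisGroup.intermediateField Gal(L/F) F L k
  rw [← Subgroup.card_eq_one, card_inertia_inf_eq_ramificationIdx k.fixingSubgroup k,
    ramificationIdx_eq_one]

theorem isUnramifiedAt_of_inertia_le [NumberField F] [NumberField L] [IsGalois F L]
    {N : Subgroup Gal(L/F)} {P : Ideal (𝓞 L)} [P.IsPrime] (hN : P.inertia Gal(L/F) ≤ N)
    (Q : Ideal (𝓞 (IntermediateField.fixedField N))) [Q.IsPrime] [P.LiesOver Q] :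
    Algebra.IsUnramifiedAt (𝓞 F) Q := by
  have : IsGaloisGroup N (IntermediateField.fixedField N) L :=
    IsGaloisGroup.subgroup Gal(L/F) F L N
  have htower := ramificationIdx_tower (R := 𝓞 F) Q P
  rw [← card_inertia_eq_ramificationIdx (G := Gal(L/F)) P,
    ← card_inertia_inf_eq_ramificationIdx N (IntermediateField.fixedField N) P,
    inf_eq_left.mpr hN] at htower
  rw [← ramificationIdx_eq_one_iff]
  exact (right_eq_mul₀ Nat.card_pos.ne').mp htower

theorem eq_one_of_mem_fixingSubgroup_of_mem_stabilizer {k : IntermediateField F L}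
    {w : InfinitePlace L} [IsGalois k L] (h : w.IsUnramified k)
    {σ : Gal(L/F)} (hσ : σ ∈ k.fixingSubgroup)
    (hw : σ ∈ MulAction.stabilizer Gal(L/F) w) : σ = 1 := by
  let e := IntermediateField.fixingSubgroupEquiv k
  have hmem : e ⟨σ, hσ⟩ ∈ MulAction.stabilizer Gal(L/k) w := hw
  rw [h.stabilizer_eq_bot, Subgroup.mem_bot, EmbeddingLike.map_eq_one_iff] at hmem
  exact congrArg Subtype.val hmem

theorem isUnramified_comap_of_stabilizer_le [NumberField F] [NumberField L] [IsGalois F L]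
    {N : Subgroup Gal(L/F)} {w : InfinitePlace L} (hN : MulAction.stabilizer Gal(L/F) w ≤ N) :
    (w.comap (algebraMap (IntermediateField.fixedField N) L)).IsUnramified F := by
  by_contra hv
  rw [InfinitePlace.not_isUnramified_iff] at hv
  have hw : ¬ w.IsUnramified F := InfinitePlace.not_isUnramified_iff.mpr ⟨hv.1.of_comap, hv.2⟩
  rw [InfinitePlace.isUnramified_iff_stabilizer_eq_bot, Subgroup.eq_bot_iff_forall] at hw
  push Not at hw
  obtain ⟨σ, hσ, hσ1⟩ := hw
  have hσN : σ ∈ (IntermediateField.fixedField N).fixingSubgroup := by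
    rw [IntermediateField.fixingSubgroup_fixedField]
    exact hN hσ
  exact hσ1 (eq_one_of_mem_fixingSubgroup_of_mem_stabilizer
    (InfinitePlace.isUnramified_iff.mpr (.inr hv.1)) hσN hσ)

theorem orderOf_eq_two_of_mem_stabilizer {w : InfinitePlace L} {σ : Gal(L/F)}
    (hσ : σ ∈ MulAction.stabilizer Gal(L/F) w) (h1 : σ ≠ 1) : orderOf σ = 2 := by
  have hdvd := Subgroup.orderOf_dvd_natCard _ hσ
  have hne := mt orderOf_eq_one_iff.mp h1
  rcases InfinitePlace.nat_card_stabilizer_eq_one_or_two F w with h | h <;> rw [h] at hdvd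
  · exact absurd (Nat.dvd_one.mp hdvd) hne
  · exact ((Nat.dvd_prime Nat.prime_two).mp hdvd).resolve_left hne

end Ramification

section GroupTheory

variable {G : Type*} [Group G]

theorem exists_le_index_eq_of_card_eq_prime_pow {p n : ℕ} [Fact p.Prime]
    (hG : Nat.card G = p ^ n) {N : Subgroup G} (hN : N ≠ ⊤) :
    ∃ M : Subgroup G, N ≤ M ∧ M.index = p := by
  have hp : 0 < p := Nat.Prime.pos Fact.out
  have : Finite G := Nat.finite_of_card_ne_zero (hG ▸ (pow_pos hp n).ne')
  obtain ⟨m, hmn, hNm⟩ := (Nat.dvd_prime_pow Fact.out).mp (hG ▸ N.card_subgroup_dvd_card)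
  obtain ⟨k, rfl⟩ : ∃ k, n = k + 1 := by
    refine Nat.exists_eq_succ_of_ne_zero fun h0 => hN (N.eq_top_of_card_eq ?_)
    rw [hNm, hG, show m = n by omega]
  have hmk : m ≤ k := Nat.lt_succ_iff.mp (lt_of_le_of_ne hmn fun h =>
    hN (N.eq_top_of_card_eq (by rw [hNm, hG, h])))
  obtain ⟨M, hM, hNM⟩ := Sylow.exists_subgroup_card_pow_prime_le p (m := k)
    (hG ▸ pow_dvd_pow p k.le_succ) N hNm hmk
  refine ⟨M, hNM, Nat.eq_of_mul_eq_mul_left (pow_pos hp k) ?_⟩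
  rw [← hM, M.card_mul_index, hG, hM, pow_succ]

theorem notMem_and_orderOf_eq_two_of_inf_eq_bot {I H : Subgroup G} (hH : H.index = 2)
    (hIH : I ⊓ H = ⊥) {g : G} (hg : g ∈ I) (h1 : g ≠ 1) : g ∉ H ∧ orderOf g = 2 := by
  have heq_one {x : G} (hxI : x ∈ I) (hxH : x ∈ H) : x = 1 :=
    Subgroup.disjoint_def.mp (disjoint_iff.mpr hIH) hxI hxH
  refine ⟨fun hgH => h1 (heq_one hg hgH), orderOf_eq_prime ?_ h1⟩
  rw [sq]
  exact heq_one (mul_mem hg hg) (Subgroup.mul_self_mem_of_index_two hH g)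

theorem le_closure_of_forall_ne_one {H : Subgroup G} {S : Set G}
    (h : ∀ g ∈ H, g ≠ 1 → g ∈ S) : H ≤ Subgroup.closure S := fun g hg => by
  by_cases h1 : g = 1
  · rw [h1]; exact one_mem _
  · exact Subgroup.subset_closure (h g hg h1)

end GroupTheory

section GaloisGroups

open NumberField Ideal Module

variable {F L : Type*} [Field F] [NumberField F] [Field L] [NumberField L] [Algebra F L]
  [IsGalois F L]

theorem exists_unramified_quadratic_of_inertia_le {n : ℕ} (hn : finrank F L = 2 ^ n)
    {N : Subgroup Gal(L/F)} (hN : N ≠ ⊤)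
    (hfin : ∀ (P : Ideal (𝓞 L)) [P.IsPrime], P ≠ ⊥ → P.inertia Gal(L/F) ≤ N)
    (hinf : ∀ w : InfinitePlace L, MulAction.stabilizer Gal(L/F) w ≤ N) :
    ∃ K : IntermediateField F L, finrank F K = 2 ∧
      UnramifiedAtFinitePrimes F K ∧ IsUnramifiedAtInfinitePlaces F K := by
  obtain ⟨M, hNM, hM⟩ := exists_le_index_eq_of_card_eq_prime_pow
    ((IsGalois.card_aut_eq_finrank F L).trans hn) hN
  refine ⟨IntermediateField.fixedField M, ?_, ?_, ⟨fun v => ?_⟩⟩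
  · rw [IntermediateField.finrank_eq_fixingSubgroup_index,
      IntermediateField.fixingSubgroup_fixedField, hM]
  · intro Q hQ hQ0
    obtain ⟨⟨P, hP, hPQ⟩⟩ := (inferInstance : Nonempty (Q.primesOver (𝓞 L)))
    have hP0 : P ≠ ⊥ := ne_bot_of_liesOver_of_ne_bot hQ0 P
    exact isUnramifiedAt_of_inertia_le ((hfin P hP0).trans hNM) Q
  · obtain ⟨w, rfl⟩ := InfinitePlace.comap_surjective (K := L) v
    exact isUnramified_comap_of_stabilizer_le ((hinf w).trans hNM)

theorem eq_top_of_inertia_le_of_odd_classNumber (hodd : Odd (classNumber F)) {n : ℕ}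
    (hn : finrank F L = 2 ^ n) {N : Subgroup Gal(L/F)}
    (hfin : ∀ (P : Ideal (𝓞 L)) [P.IsPrime], P ≠ ⊥ → P.inertia Gal(L/F) ≤ N)
    (hinf : ∀ w : InfinitePlace L, MulAction.stabilizer Gal(L/F) w ≤ N) : N = ⊤ := by
  by_contra hN
  obtain ⟨K, h2, hfinK, hinfK⟩ := exists_unramified_quadratic_of_inertia_le hn hN hfin hinf
  have : Algebra.IsQuadraticExtension F K := { finrank_eq_two' := h2 }
  exact Nat.not_even_iff_odd.mpr hodd (even_classNumber_of_unramified_quadratic h2 hfinK)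

theorem closure_orderOf_eq_two_eq_top (hodd : Odd (classNumber F)) {n : ℕ}
    (hn : finrank F L = 2 ^ n) {k : IntermediateField F L} (hk : finrank F k = 2)
    (hun : UnramifiedAtFinitePrimes k L) :
    Subgroup.closure {σ : Gal(L/F) | orderOf σ = 2} = ⊤ := by
  rw [IntermediateField.finrank_eq_fixingSubgroup_index] at hk
  refine eq_top_of_inertia_le_of_odd_classNumber hodd hn (fun P _ hP => ?_) fun w => ?_
  · exact le_closure_of_forall_ne_one fun σ hσ h1 => (notMem_and_orderOf_eq_two_of_inf_eq_bot hk
      (inertia_inf_fixingSubgroup_eq_bot k P (hun P hP)) hσ h1).2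
  · exact le_closure_of_forall_ne_one fun σ hσ h1 => orderOf_eq_two_of_mem_stabilizer hσ h1

theorem generatedByInvolutionsOutside_fixingSubgroup (hodd : Odd (classNumber F)) {n : ℕ}
    (hn : finrank F L = 2 ^ n) {k : IntermediateField F L} (hk : finrank F k = 2)
    (hun : UnramifiedAtFinitePrimes k L) (hinf : IsUnramifiedAtInfinitePlaces k L) :
    GeneratedByInvolutionsOutside k.fixingSubgroup := by
  rw [IntermediateField.finrank_eq_fixingSubgroup_index] at hk
  refine eq_top_of_inertia_le_of_odd_classNumber hodd hn (fun P _ hP => ?_) fun w => ?_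
  · exact le_closure_of_forall_ne_one fun σ hσ h1 => notMem_and_orderOf_eq_two_of_inf_eq_bot hk
      (inertia_inf_fixingSubgroup_eq_bot k P (hun P hP)) hσ h1
  · refine le_closure_of_forall_ne_one fun σ hσ h1 =>
      ⟨fun hσk => h1 ?_, orderOf_eq_two_of_mem_stabilizer hσ h1⟩
    exact eq_one_of_mem_fixingSubgroup_of_mem_stabilizer (hinf.isUnramified w) hσk hσ

theorem isTableGroup_gal (hodd : Odd (classNumber F)) (h16 : finrank F L = 16)
    (hna : ¬ ∀ σ τ : Gal(L/F), σ * τ = τ * σ) {k : IntermediateField F L} (hk : finrank F k = 2)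
    (hun : UnramifiedAtFinitePrimes k L) : IsTableGroup Gal(L/F) :=
  isTableGroup_of_closure_involutions ((IsGalois.card_aut_eq_finrank F L).trans h16) hna
    (fun _ hσ => (sq _).symm.trans (orderOf_dvd_iff_pow_eq_one.mp (dvd_of_eq hσ)))
    (closure_orderOf_eq_two_eq_top hodd (n := 4) h16 hk hun)

theorem isTablePair_gal (hodd : Odd (classNumber F)) (h16 : finrank F L = 16)
    (hna : ¬ ∀ σ τ : Gal(L/F), σ * τ = τ * σ) {k : IntermediateField F L} (hk : finrank F k = 2)
    (hun : UnramifiedAtFinitePrimes k L) (hinf : IsUnramifiedAtInfinitePlaces k L) :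
    IsTablePair Gal(L/F) Gal(L/k) := by
  have hpair : IsTablePair Gal(L/F) k.fixingSubgroup :=
    isTablePair_of_generatedByInvolutionsOutside ((IsGalois.card_aut_eq_finrank F L).trans h16)
      hna (by rw [← IntermediateField.finrank_eq_fixingSubgroup_index, hk])
      (generatedByInvolutionsOutside_fixingSubgroup hodd (n := 4) h16 hk hun hinf)
  exact hpair.of_mulEquiv (MulEquiv.refl _) (IntermediateField.fixingSubgroupEquiv k).symm

end GaloisGroups

theorem mainTheorem8 :
    -- the pairs `(G, H)`, up to isomorphism, are exactly those of the table
    (∀ (G : Type*) (K : Type*) [Group G] [Group K],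
      (Nat.card G = 16 ∧ (¬ ∀ a b : G, a * b = b * a) ∧
        ∃ H : Subgroup G, H.index = 2 ∧ Nonempty (H ≃* K) ∧ GeneratedByInvolutionsOutside H) ↔
      IsTablePair G K) ∧
    -- the four pairs of the table are pairwise distinct
    (IsEmpty (DihedralGroup 8 ≃* (Cyc 2 × DihedralGroup 4)) ∧
      IsEmpty (DihedralGroup 8 ≃* C4CentralD4) ∧
      IsEmpty ((Cyc 2 × DihedralGroup 4) ≃* C4CentralD4) ∧
      IsEmpty ((Cyc 4 × Cyc 2) ≃* DihedralGroup 4)) ∧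
    -- the consequence for Galois groups over number fields of odd class number
    (∀ (F : Type*) (L : Type*) [Field F] [NumberField F] [Field L] [Algebra F L]
      [IsGalois F L],
      Odd (NumberField.classNumber F) →
      Module.finrank F L = 16 →
      (¬ ∀ σ τ : L ≃ₐ[F] L, σ * τ = τ * σ) →
      ∀ k : IntermediateField F L, Module.finrank F k = 2 →
        UnramifiedAtFinitePrimes k L →
        IsTableGroup (L ≃ₐ[F] L) ∧
        (IsUnramifiedAtInfinitePlaces k L →
          IsTablePair (L ≃ₐ[F] L) (L ≃ₐ[k] L))) := by
  refine ⟨fun G K _ _ => hasInvolutoryPair_iff_isTablePair,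
    ⟨isEmpty_dihedralGroup_eight_mulEquiv pow_four_cyc_two_prod_dihedralGroup,
      isEmpty_dihedralGroup_eight_mulEquiv pow_four_c4CentralD4,
      isEmpty_cyc_two_prod_dihedralGroup_mulEquiv_c4CentralD4,
      isEmpty_cyc_four_prod_cyc_two_mulEquiv_dihedralGroup⟩, ?_⟩
  intro F L _ _ _ _ _ hodd h16 hna k hk hun
  have : FiniteDimensional F L := Module.finite_of_finrank_pos (by omega)
  have : NumberField L := NumberField.of_module_finite F L
  exact ⟨isTableGroup_gal hodd h16 hna hk hun, fun hinf => isTablePair_gal hodd h16 hna hk hun hinf⟩
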